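/- **Proposition (sign preservation for Hamiltonians of commuting observables).** Let $Q$ be a smooth $n$-dimensional manifold (Hausdorff, second countable), with phase space $T^*Q$, natural coordinates $z=(q^i,p_i)$, canonical bracket $\{F,G\}=\sum_i(\partial_{q^i}F\,\partial_{p_i}G-\partial_{p_i}F\,\partial_{q^i}G)$, canonical one-form $\mathcal A=\sum_i p_i\,\mathrm dq^i$ and Hamiltonian vector fields $X_H=\sum_i(\partial_{p_i}H\,\partial_{q^i}-\partial_{q^i}H\,\partial_{p_i})$, and let $\hbar>0$. Let $\hat\alpha_1,\dots,\hat\alpha_N$ be (possibly unbounded) self-adjoint operators on a complex Hilbert space $\mathscr H$ which commute strongly (i.e. their resolvents commute), and let $\sigma\subset\mathbb R^N$ be their joint spectrum. Let $|x\rangle$, $x\in X$, be a complete system of joint generalized eigenstates over a $\sigma$-finite measure space $(X,\nu)$: there are a measurable map $\alpha=(\alpha_1,\dots,\alpha_N):X\to\mathbb R^N$ and a unitary operator $\mathscr H\to L^2(X,\nu)$, written $\psi\mapsto\langle x|\psi\rangle$, which turns every $\hat\alpha_i$ into the multiplication by $\alpha_i(x)$ on its maximal domain. Let $H(z,a)=\sum_{m\in\mathbb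 N^N}h_m(z)\,a^m$ with real functions $h_m$ on $T^*Q$, where the series converges for all $z\in T^*Q$, $a\in\sigma$, and $H(\cdot,a)$ is $C^2$ for every $a\in\sigma$. Put $\hat H(z)=H(z,\{\hat\alpha_i\})$, the closure of the operator $\psi\mapsto\sum_m h_m(z)\,\hat\alpha^m\psi$; the derivatives of $\hat H$ in $z$ are the closures of its strong derivatives. Let $J\subset\mathbb R$ be an open interval and let $\Upsilon:T^*Q\times J\to\mathscr H$ be a classical (pointwise, termwise defined) solution of the quantum–classical wave equation $$i\hbar\,\partial_t\Upsilon=i\hbar\sum_i\big(\partial_{q^i}\hat H\,\partial_{p_i}\Upsilon-\partial_{p_i}\hat H\,\partial_{q^i}\Upsilon\big)+\Big(\hat H-\sum_i p_i\,\partial_{p_i}\hat H\Big)\Upsilon .$$ Suppose that the projection $\Upsilon(z,x,t)=\langle x|\Upsilon(z,t)\rangle$ has a representative which for $\nu$-almost every $x$ is $C^2$ in $(z,t)$, and put $$\widetilde{\mathcal D}(z,x,t)=|\Upsilon|^2+\sum_i\partial_{p_i}\big(p_i|\Upsilon|^2\big)+i\hbar\{\Upsilon,\bar\Upsilon\}.$$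 Then for $\nu$-almost every $x$, with $\alpha=\alpha(x)\in\sigma$: 1. $\Upsilon(\cdot,x,\cdot)$ solves the Koopman–van Hove equation $i\hbar\,\partial_t\Upsilon=i\hbar\{H(\cdot,\alpha),\Upsilon\}-\big(\mathcal A\cdot X_{H(\cdot,\alpha)}-H(\cdot,\alpha)\big)\Upsilon$ on $T^*Q\times J$; 2. $\widetilde{\mathcal D}(\cdot,x,\cdot)$ solves the Liouville equation $\partial_t\widetilde{\mathcal D}=\{H(\cdot,\alpha),\widetilde{\mathcal D}\}$ on $T^*Q\times J$; 3. $\widetilde{\mathcal D}(\gamma(t),x,t)=\widetilde{\mathcal D}(\gamma(s),x,s)$ for all $s,t\in J$ and every integral curve $\gamma$ of $X_{H(\cdot,\alpha)}$ between the times $s$ and $t$; 4. if $X_{H(\cdot,\alpha)}$ is complete, the sign of $\widetilde{\mathcal D}$ is preserved in time: if $\widetilde{\mathcal D}(\cdot,x,s)\ge0$ (respectively $\le0$) on $T^*Q$ for one $s\in J$, then the same holds at all times $t\in J$. -/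

import Mathlib

open Set Filter Topology MeasureTheory Bundle
open scoped Manifold ContDiff ENNReal ComplexConjugate

noncomputable section

namespace Hybrid

/-! ### The classical phase space `T*Q` -/

section Classical

/-- The model space `ℝⁿ` of the configuration manifold. -/
abbrev Model (n : ℕ) : Type := EuclideanSpace ℝ (Fin n)

/-- The phase space `T*Q`: the total space of the cotangent bundle of `Q`. The preferred chart of
this manifold at `z = (q, p)` is the natural chart `(qⁱ, pᵢ)` induced by the preferred chart of `Q`
at `q`, with values in `ℝⁿ × (ℝⁿ)*`. -/
abbrev PhaseSpace (n : ℕ) (Q : Type*) [TopologicalSpace Q] [ChartedSpace (Model n) Q] : Type _ :=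
  TotalSpace (Model n →L[ℝ] ℝ) (fun q : Q => TangentSpace (𝓡 n) q →L[ℝ] Trivial Q ℝ q)

/-- The model with corners of `T*Q`. -/
abbrev phaseModel (n : ℕ) : ModelWithCorners ℝ (Model n × (Model n →L[ℝ] ℝ))
    (ModelProd (Model n) (Model n →L[ℝ] ℝ)) :=
  (𝓡 n).prod 𝓘(ℝ, Model n →L[ℝ] ℝ)

variable {n : ℕ} {Q : Type*} [TopologicalSpace Q] [ChartedSpace (Model n) Q]
  [IsManifold (𝓡 n) ∞ Q]

/-- The coordinate vector `∂/∂qⁱ` in `ℝⁿ × (ℝⁿ)*`. -/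
def dirQ (i : Fin n) : Model n × (Model n →L[ℝ] ℝ) := (EuclideanSpace.single i 1, 0)

/-- The coordinate vector `∂/∂pᵢ` in `ℝⁿ × (ℝⁿ)*`. -/
def dirP (i : Fin n) : Model n × (Model n →L[ℝ] ℝ) := (0, EuclideanSpace.proj i)

/-- The derivative at `z` of a function on `T*Q` with values in a normed space, in the direction of
the tangent vector which has components `v` in the natural coordinates at `z`. -/
def dirDeriv {V : Type*} [NormedAddCommGroup V] [NormedSpace ℝ V]
    (v : Model n × (Model n →L[ℝ] ℝ)) (F : PhaseSpace n Q → V) (z : PhaseSpace n Q) : V :=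
  (mfderiv (phaseModel n) 𝓘(ℝ, V) F z : Model n × (Model n →L[ℝ] ℝ) →L[ℝ] V) v

/-- `∂F/∂qⁱ` in the natural coordinates at `z`. -/
abbrev partialQ {V : Type*} [NormedAddCommGroup V] [NormedSpace ℝ V]
    (i : Fin n) (F : PhaseSpace n Q → V) (z : PhaseSpace n Q) : V := dirDeriv (dirQ i) F z

/-- `∂F/∂pᵢ` in the natural coordinates at `z`. -/
abbrev partialP {V : Type*} [NormedAddCommGroup V] [NormedSpace ℝ V]
    (i : Fin n) (F : PhaseSpace n Q → V) (z : PhaseSpace n Q) : V := dirDeriv (dirP i) F z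

/-- The function `z ↦ pᵢ(z)` of the natural chart at `z₀`. -/
def momentum (z₀ : PhaseSpace n Q) (i : Fin n) (z : PhaseSpace n Q) : ℝ :=
  (extChartAt (phaseModel n) z₀ z).2 (EuclideanSpace.single i 1)

/-- The canonical Poisson bracket
`{F, G} = ∑ᵢ (∂F/∂qⁱ ∂G/∂pᵢ - ∂F/∂pᵢ ∂G/∂qⁱ)` of real or complex functions on `T*Q`. -/
def poisson {𝕜 : Type*} [RCLike 𝕜] (F G : PhaseSpace n Q → 𝕜) (z : PhaseSpace n Q) : 𝕜 :=
  ∑ i, (partialQ i F z * partialP i G z - partialP i F z * partialQ i G z)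

/-- The Hamiltonian vector field `X_H = ∑ᵢ (∂H/∂pᵢ ∂/∂qⁱ - ∂H/∂qⁱ ∂/∂pᵢ)`. -/
def hamiltonianField (H : PhaseSpace n Q → ℝ) (z : PhaseSpace n Q) :
    TangentSpace (phaseModel n) z :=
  (∑ i, (partialP i H z • dirQ i - partialQ i H z • dirP i) : Model n × (Model n →L[ℝ] ℝ))

/-- `𝒜 · X_H = ∑ᵢ pᵢ ∂H/∂pᵢ`. -/
def liouvilleTerm (H : PhaseSpace n Q → ℝ) (z : PhaseSpace n Q) : ℝ :=
  ∑ i, momentum z i z * partialP i H z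

/-- The covariant Liouvillian `iħ {H, Ψ} - (𝒜 · X_H - H) Ψ`. -/
def covariantLiouvillian (ħ : ℝ) (H : PhaseSpace n Q → ℝ) (Ψ : PhaseSpace n Q → ℂ)
    (z : PhaseSpace n Q) : ℂ :=
  Complex.I * ħ * poisson (fun w => (H w : ℂ)) Ψ z - ((liouvilleTerm H z - H z : ℝ) : ℂ) * Ψ z

/-- `Ψ` is a classical solution on the time set `J` of the Koopman-van Hove equation
`iħ ∂Ψ/∂t = iħ {H, Ψ} - (𝒜 · X_H - H) Ψ`. -/
def SolvesKvH (ħ : ℝ) (H : PhaseSpace n Q → ℝ) (J : Set ℝ) (Ψ : PhaseSpace n Q → ℝ → ℂ) : Prop :=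
  ∀ t ∈ J, ∀ z, DifferentiableAt ℝ (Ψ z) t ∧
    MDifferentiableAt (phaseModel n) 𝓘(ℝ, ℂ) (fun w => Ψ w t) z ∧
    Complex.I * ħ * deriv (Ψ z) t = covariantLiouvillian ħ H (fun w => Ψ w t) z

/-- `ρ` is a classical solution on the time set `J` of the Liouville equation
`∂ρ/∂t = {H, ρ}`. -/
def SolvesLiouville (H : PhaseSpace n Q → ℝ) (J : Set ℝ) (ρ : PhaseSpace n Q → ℝ → ℝ) : Prop :=
  ∀ t ∈ J, ∀ z, MDifferentiableAt (phaseModel n) 𝓘(ℝ, ℝ) (fun w => ρ w t) z ∧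
    HasDerivAt (ρ z) (poisson H (fun w => ρ w t) z) t

/-- The vector field `X_H` is complete: through every point there is an integral curve defined on
the whole time axis. -/
def IsCompleteHamiltonian (H : PhaseSpace n Q → ℝ) : Prop :=
  ∀ z, ∃ γ : ℝ → PhaseSpace n Q, γ 0 = z ∧ IsMIntegralCurve γ (hamiltonianField H)

/-- The density `|Ψ|² + ∑ᵢ ∂(pᵢ |Ψ|²)/∂pᵢ + iħ {Ψ, Ψ̄}`. The last term is real, see
`ofReal_density` below. -/
def density (ħ : ℝ) (Ψ : PhaseSpace n Q → ℂ) (z : PhaseSpace n Q) : ℝ :=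
  ‖Ψ z‖ ^ 2 + ∑ i, partialP i (fun w => momentum z i w * ‖Ψ w‖ ^ 2) z +
    (Complex.I * ħ * poisson Ψ (fun w => conj (Ψ w)) z).re

/-- The term `iħ {Ψ, Ψ̄}` is real, so that `density` is the full complex expression. -/
theorem ofReal_density (ħ : ℝ) (Ψ : PhaseSpace n Q → ℂ) (z : PhaseSpace n Q)
    (hΨ : MDifferentiableAt (phaseModel n) 𝓘(ℝ, ℂ) Ψ z) :
    ((density ħ Ψ z : ℝ) : ℂ) = ((‖Ψ z‖ ^ 2 : ℝ) : ℂ) +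
      ((∑ i, partialP i (fun w => momentum z i w * ‖Ψ w‖ ^ 2) z : ℝ) : ℂ) +
      Complex.I * ħ * poisson Ψ (fun w => conj (Ψ w)) z := by
  have hc : ∀ v, dirDeriv v (fun w => conj (Ψ w)) z = conj (dirDeriv v Ψ z) := by
    intro v
    have h1 : HasMFDerivAt 𝓘(ℝ, ℂ) 𝓘(ℝ, ℂ) (fun c : ℂ => conj c) (Ψ z)
        (Complex.conjCLE : ℂ →L[ℝ] ℂ) :=
      (Complex.conjCLE : ℂ →L[ℝ] ℂ).hasFDerivAt.hasMFDerivAt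
    have h2 := (h1.comp z hΨ.hasMFDerivAt).mfderiv
    have h3 : (fun w => conj (Ψ w)) = (fun c : ℂ => conj c) ∘ Ψ := rfl
    unfold dirDeriv
    rw [h3, h2]
    rfl
  have him : (Complex.I * ħ * poisson Ψ (fun w => conj (Ψ w)) z).im = 0 := by
    simp only [poisson, partialQ, partialP, hc]
    simp only [Complex.mul_im, Complex.mul_re, Complex.I_re, Complex.I_im, Complex.ofReal_re,
      Complex.ofReal_im, Complex.re_sum, Complex.sub_re, Complex.conj_re, Complex.conj_im]
    simp only [zero_mul, mul_zero, one_mul, sub_zero, zero_add]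
    rw [Finset.sum_eq_zero]
    · ring
    · intro i _
      ring
  have hre : (((Complex.I * ħ * poisson Ψ (fun w => conj (Ψ w)) z).re : ℝ) : ℂ) =
      Complex.I * ħ * poisson Ψ (fun w => conj (Ψ w)) z :=
    Complex.ext (by simp) (by rw [him]; simp)
  unfold density
  rw [Complex.ofReal_add, Complex.ofReal_add, hre]

end Classical

/-! ### Quantum observables, analytic functions of them, and joint eigenstates -/

section Quantum

variable {𝓗 : Type*} [NormedAddCommGroup 𝓗] [InnerProductSpace ℂ 𝓗] {N : ℕ}

/-- Two unbounded operators commute (strongly): all their resolvents commute. Here `u` is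
`(A - a)⁻¹ x` and `v` is `(B - b)⁻¹ u`, while `u'` is `(B - b)⁻¹ x` and `v'` is `(A - a)⁻¹ u'`. -/
def StronglyCommute (A B : 𝓗 →ₗ.[ℂ] 𝓗) : Prop :=
  ∀ a b : ℂ, a.im ≠ 0 → b.im ≠ 0 → ∀ x u v u' v' : 𝓗,
    (u, x + a • u) ∈ A.graph → (v, u + b • v) ∈ B.graph →
    (u', x + b • u') ∈ B.graph → (v', u' + a • v') ∈ A.graph → v = v'

/-- The joint spectrum of finitely many observables, in terms of approximate joint eigenvectors. -/
def jointSpectrum (α : Fin N → 𝓗 →ₗ.[ℂ] 𝓗) : Set (Fin N → ℝ) :=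
  {a | ∀ ε > 0, ∃ ψ : 𝓗, ‖ψ‖ = 1 ∧
    ∀ i, ∃ φ : 𝓗, (ψ, φ) ∈ (α i).graph ∧ ‖φ - (a i : ℂ) • ψ‖ < ε}

/-- `WordApply α [i₁, …, iₖ] ψ φ`: the vector `ψ` lies in the domain of `α_{i₁} ⋯ α_{iₖ}`, and
`φ = α_{i₁} ⋯ α_{iₖ} ψ`. -/
def WordApply (α : Fin N → 𝓗 →ₗ.[ℂ] 𝓗) : List (Fin N) → 𝓗 → 𝓗 → Prop
  | [], ψ, φ => φ = ψ
  | i :: w, ψ, φ => ∃ χ, WordApply α w ψ χ ∧ (χ, φ) ∈ (α i).graph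

/-- `φ = α₁^{m₁} ⋯ α_N^{m_N} ψ`, the factors being taken in some order in which `ψ` lies in the
domain of the product. -/
def MonomialApply (α : Fin N → 𝓗 →ₗ.[ℂ] 𝓗) (m : Fin N → ℕ) (ψ φ : 𝓗) : Prop :=
  ∃ w : List (Fin N), (∀ i, w.count i = m i) ∧ WordApply α w ψ φ

/-- An operator on `𝓗`, possibly unbounded and given by its graph: `(ψ, φ) ∈ T` means that `ψ` is in
the domain of `T` and `T ψ = φ`. -/
abbrev OpGraph (𝓗 : Type*) : Type _ := Set (𝓗 × 𝓗)

/-- The analytic function `∑ₘ c_m α^m` of the observables: the closure of the operator which is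
given by the convergence of the power series on a vector. -/
def analyticFunction (α : Fin N → 𝓗 →ₗ.[ℂ] 𝓗) (c : (Fin N → ℕ) → ℝ) : OpGraph 𝓗 :=
  closure {x | ∃ χ : (Fin N → ℕ) → 𝓗, (∀ m, c m ≠ 0 → MonomialApply α m x.1 (χ m)) ∧
    HasSum (fun m => (c m : ℂ) • χ m) x.2}

/-- A complete system of joint generalized eigenstates `|x⟩`, labelled by the points `x` of a
measure space: `α_i |x⟩ = eigenvalue x i |x⟩` and `∫ |x⟩⟨x| dν(x) = 1`. The unitary operator
`proj : 𝓗 → L²(ν)` is `ψ ↦ (x ↦ ⟨x|ψ⟩)`; it turns every `α_i` into the multiplication by the `i`-th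
joint eigenvalue, on its maximal domain. -/
structure JointEigenstates (α : Fin N → 𝓗 →ₗ.[ℂ] 𝓗) {X : Type*} [MeasurableSpace X]
    (ν : Measure X) where
  /-- the joint eigenvalue `(α₁, …, α_N)` which belongs to a label -/
  eigenvalue : X → Fin N → ℝ
  measurable_eigenvalue : Measurable eigenvalue
  /-- the projection `ψ ↦ ⟨x|ψ⟩` -/
  proj : 𝓗 ≃ₗᵢ[ℂ] Lp ℂ 2 ν
  diagonal : ∀ (i : Fin N) (ψ φ : 𝓗), (ψ, φ) ∈ (α i).graph ↔
    (proj φ : X → ℂ) =ᵐ[ν] fun x => (eigenvalue x i : ℂ) * (proj ψ : X → ℂ) x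

end Quantum

/-! ### The quantum-classical wave equation -/

section HybridEquation

variable {n : ℕ} {Q : Type*} [TopologicalSpace Q] [ChartedSpace (Model n) Q]
  [IsManifold (𝓡 n) ∞ Q] {𝓗 : Type*} [NormedAddCommGroup 𝓗] [InnerProductSpace ℂ 𝓗]

/-- The derivative at `z`, in the direction `v`, of an operator-valued function `T` on phase space:
the closure of the strong derivative `ψ ↦ ∂_v (T(·) ψ)(z)`, which is defined on those `ψ` that lie in
the domain of `T(w)` for all `w` near `z` and for which `w ↦ T(w) ψ` is differentiable at `z`. -/
def opDeriv (v : Model n × (Model n →L[ℝ] ℝ)) (T : PhaseSpace n Q → OpGraph 𝓗)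
    (z : PhaseSpace n Q) : OpGraph 𝓗 :=
  closure {x | ∃ F : PhaseSpace n Q → 𝓗, (∀ᶠ w in 𝓝 z, (x.1, F w) ∈ T w) ∧
    MDifferentiableAt (phaseModel n) 𝓘(ℝ, 𝓗) F z ∧ dirDeriv v F z = x.2}

/-- The hybrid Liouvillian of the hybrid Hamiltonian `T`, applied to `Υ`: all terms of
`iħ ∑ᵢ (∂T/∂qⁱ ∂Υ/∂pᵢ - ∂T/∂pᵢ ∂Υ/∂qⁱ) + (T - ∑ᵢ pᵢ ∂T/∂pᵢ) Υ` are defined at `z`, and their sum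
is `χ`. -/
def HybridLiouvillian (ħ : ℝ) (T : PhaseSpace n Q → OpGraph 𝓗) (Υ : PhaseSpace n Q → 𝓗)
    (z : PhaseSpace n Q) (χ : 𝓗) : Prop :=
  ∃ (a b d : Fin n → 𝓗) (c : 𝓗),
    (∀ i, (partialP i Υ z, a i) ∈ opDeriv (dirQ i) T z) ∧
    (∀ i, (partialQ i Υ z, b i) ∈ opDeriv (dirP i) T z) ∧
    (∀ i, (Υ z, d i) ∈ opDeriv (dirP i) T z) ∧
    (Υ z, c) ∈ T z ∧
    χ = (Complex.I * ħ) • ∑ i, (a i - b i) + (c - ∑ i, (momentum z i z : ℂ) • d i)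

/-- `Υ` is a solution, on the time set `J`, of the quantum-classical wave equation
`iħ ∂Υ/∂t = {iħ T, Υ} + (T - 𝒜 · X_T) Υ` with the hybrid Hamiltonian `T`. -/
def SolvesHybrid (ħ : ℝ) (T : PhaseSpace n Q → OpGraph 𝓗) (J : Set ℝ)
    (Υ : PhaseSpace n Q → ℝ → 𝓗) : Prop :=
  ∀ t ∈ J, ∀ z, DifferentiableAt ℝ (Υ z) t ∧
    MDifferentiableAt (phaseModel n) 𝓘(ℝ, 𝓗) (fun w => Υ w t) z ∧
    HybridLiouvillian ħ T (fun w => Υ w t) z ((Complex.I * ħ) • deriv (Υ z) t)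

end HybridEquation

end Hybrid

end

/-! The projection ⟨x|·⟩ diagonalises the observables, so it should turn Ĥ(z) and its derivatives
into multiplication by H(z, α(x)) and its derivatives. Power series of the observables and strong
derivatives are limits in the Hilbert space, and so are the closures taken afterwards. A limit in L²
is an almost everywhere limit along a subsequence, so the multiplication property survives all of
them (`ActsAs.closure`, `actsAs_analyticFunction`, `actsAs_opDeriv`). Convergence of the series and
regularity of H are available because almost every α(x) lies in the joint spectrum
(`ae_eigenvalue_mem_jointSpectrum`). For each fixed (z, t) the wave equation thus becomes the
Koopman–van Hove equation for almost every x. The exceptional null set depends on (z, t), so only a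
countable dense set of points is used; since both sides are continuous, `solvesKvH_of_dense`
recovers the remaining ones.

Write Ψ = u + iv, E = ∑ pᵢ ∂/∂pᵢ and L = EH - H. Then the density is (1 + n)(u² + v²) + 2(u Eu + v
Ev) + 2ħ{u, v}, and the equation is transport by {H, ·} together with a rotation of (u, v) at rate
L/ħ. The rotation leaves u² + v² and its Euler derivative unchanged. Since the bracket lowers the
degree in p by one, E{H, u} = {H, Eu} + {L, u}; hence transport adds {L, u² + v²} to the middle
term. By the Jacobi identity transport adds nothing to the last term, whereas the rotation adds -{L,
u² + v²}. The two contributions cancel, which is the Liouville equation (`flatDensity_liouville`).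
The density is therefore constant along integral curves, and a complete field supplies such a curve
through every point, so signs persist.

On T*Q the partial derivatives at z refer to the chart belonging to z, which changes with z. Changes
of natural charts are point transformations, so they preserve the symplectic form and the Euler
field. Brackets and densities can therefore be read in one fixed chart, where the computation takes
place on a vector space that includes time. -/

noncomputable section

namespace Hybrid

/-! ### The Koopman-van Hove equation on a vector space with a constant Poisson tensor -/

section Flat

variable {W : Type*} [NormedAddCommGroup W] [NormedSpace ℝ W]

/-- The Poisson bracket of the constant Poisson tensor `S`. -/
def flatBracket (S : (W →L[ℝ] ℝ) →L[ℝ] W) (F G : W → ℝ) (w : W) : ℝ :=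
  fderiv ℝ F w (S (fderiv ℝ G w))

/-- The derivative along the linear vector field `A`. -/
def linearFieldDeriv (A : W →L[ℝ] W) (F : W → ℝ) (w : W) : ℝ := fderiv ℝ F w (A w)

/-- The density of the wave function `u + i v`, on a vector space with Poisson tensor `S` and
Euler field `A`. -/
def flatDensity (S : (W →L[ℝ] ℝ) →L[ℝ] W) (A : W →L[ℝ] W) (k ħ : ℝ) (u v : W → ℝ) (w : W) : ℝ :=
  k * (u w ^ 2 + v w ^ 2) +
    2 * (u w * linearFieldDeriv A u w + v w * linearFieldDeriv A v w) +
    2 * ħ * flatBracket S u v w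

theorem hasFDerivAt_fderiv_of_contDiffAt {F : W → ℝ} {w : W} (hF : ContDiffAt ℝ 2 F w) :
    HasFDerivAt (fderiv ℝ F) (fderiv ℝ (fderiv ℝ F) w) w :=
  ((hF.fderiv_right (m := 1) (by norm_num)).differentiableAt (by norm_num)).hasFDerivAt

theorem hasFDerivAt_flatBracket (S : (W →L[ℝ] ℝ) →L[ℝ] W) {F G : W → ℝ} {w : W}
    (hF : ContDiffAt ℝ 2 F w) (hG : ContDiffAt ℝ 2 G w) :
    HasFDerivAt (flatBracket S F G)
      ((fderiv ℝ F w).comp (S.comp (fderiv ℝ (fderiv ℝ G) w)) +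
        (fderiv ℝ (fderiv ℝ F) w).flip (S (fderiv ℝ G w))) w :=
  (hasFDerivAt_fderiv_of_contDiffAt hF).clm_apply
    (S.hasFDerivAt.comp w (hasFDerivAt_fderiv_of_contDiffAt hG))

theorem hasFDerivAt_linearFieldDeriv (A : W →L[ℝ] W) {F : W → ℝ} {w : W}
    (hF : ContDiffAt ℝ 2 F w) :
    HasFDerivAt (linearFieldDeriv A F)
      ((fderiv ℝ F w).comp A + (fderiv ℝ (fderiv ℝ F) w).flip (A w)) w :=
  (hasFDerivAt_fderiv_of_contDiffAt hF).clm_apply A.hasFDerivAt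

theorem snd_fderiv_symm {F : W → ℝ} {w : W} (hF : ContDiffAt ℝ 2 F w) (a b : W) :
    fderiv ℝ (fderiv ℝ F) w a b = fderiv ℝ (fderiv ℝ F) w b a :=
  (hF.isSymmSndFDerivAt (by simp)).eq a b

/-- The real form of the Koopman-van Hove equation for `u + i v`, with the time direction `T`, at
the point `w`. -/
def FlatKvHAt (S : (W →L[ℝ] ℝ) →L[ℝ] W) (A : W →L[ℝ] W) (T : W) (ħ : ℝ) (H u v : W → ℝ) (w : W) :
    Prop :=
  fderiv ℝ u w T = flatBracket S H u w - ħ⁻¹ * ((linearFieldDeriv A H w - H w) * v w) ∧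
  fderiv ℝ v w T = flatBracket S H v w + ħ⁻¹ * ((linearFieldDeriv A H w - H w) * u w)

/-- The density of a solution of the Koopman-van Hove equation solves the Liouville equation. -/
theorem flatDensity_liouville {S : (W →L[ℝ] ℝ) →L[ℝ] W} {A : W →L[ℝ] W} {T : W} {k ħ : ℝ}
    (hS : ∀ l m : W →L[ℝ] ℝ, l (S m) = -m (S l))
    (hA : ∀ l m : W →L[ℝ] ℝ, l (A (S m)) - m (A (S l)) = l (S m)) (hT : A T = 0) (hħ : ħ ≠ 0)
    {H u v : W → ℝ} {U : Set W} (hU : IsOpen U) (hH : ContDiffOn ℝ 2 H U)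
    (hu : ContDiffOn ℝ 2 u U) (hv : ContDiffOn ℝ 2 v U)
    (h : ∀ w ∈ U, FlatKvHAt S A T ħ H u v w) {w : W} (hw : w ∈ U) :
    DifferentiableAt ℝ (flatDensity S A k ħ u v) w ∧
      fderiv ℝ (flatDensity S A k ħ u v) w T = flatBracket S H (flatDensity S A k ħ u v) w := by
  have hUw := hU.mem_nhds hw
  have hH2 := hH.contDiffAt hUw
  have hu2 := hu.contDiffAt hUw
  have hv2 := hv.contDiffAt hUw
  have hHd := (hH2.differentiableAt (by norm_num)).hasFDerivAt
  have hud := (hu2.differentiableAt (by norm_num)).hasFDerivAt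
  have hvd := (hv2.differentiableAt (by norm_num)).hasFDerivAt
  have hL := (hasFDerivAt_linearFieldDeriv A hH2).sub hHd
  have hD := ((((hud.pow 2).add (hvd.pow 2)).const_mul k).add
    (((hud.mul (hasFDerivAt_linearFieldDeriv A hu2)).add
      (hvd.mul (hasFDerivAt_linearFieldDeriv A hv2))).const_mul 2)).add
    ((hasFDerivAt_flatBracket S hu2 hv2).const_mul (2 * ħ))
  -- Both equations hold on all of `U`, so they may be differentiated at `w` in any direction `s`.
  -- This replaces the mixed second derivatives in `s` and `T` by expressions without time
  -- derivatives.
  have e1 : ∀ s, _ := fun s => DFunLike.congr_fun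
    (((hasFDerivAt_fderiv_of_contDiffAt hu2).clm_apply (hasFDerivAt_const T w)).unique
      (((hasFDerivAt_flatBracket S hH2 hu2).sub ((hL.mul hvd).const_mul ħ⁻¹)).congr_of_eventuallyEq
        (by filter_upwards [hUw] with x hx using (h x hx).1))) s
  have e2 : ∀ s, _ := fun s => DFunLike.congr_fun
    (((hasFDerivAt_fderiv_of_contDiffAt hv2).clm_apply (hasFDerivAt_const T w)).unique
      (((hasFDerivAt_flatBracket S hH2 hv2).add ((hL.mul hud).const_mul ħ⁻¹)).congr_of_eventuallyEq
        (by filter_upwards [hUw] with x hx using (h x hx).2))) s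
  have hD' : HasFDerivAt (flatDensity S A k ħ u v) _ w := hD
  refine ⟨hD'.differentiableAt, ?_⟩
  obtain ⟨h1, h2⟩ := h w hw
  unfold flatBracket
  -- Antisymmetry makes the bracket minus the derivative of the density along `S dH`, so the one
  -- explicit derivative `hD'` serves both sides.
  rw [hS, hD'.fderiv]
  -- Antisymmetry restricted to Hessians: it writes every second-order term as a Hessian evaluated
  -- on two vectors, and unlike `hS` it does not loop in `simp`.
  have K : ∀ (l : W →L[ℝ] ℝ) (b : W →L[ℝ] W →L[ℝ] ℝ) s, l (S (b s)) = -(b s (S l)) :=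
    fun _ _ _ => hS _ _
  simp only [flatBracket, linearFieldDeriv, Pi.sub_apply, add_apply, sub_apply, smul_apply,
    zero_apply, ContinuousLinearMap.comp_apply, ContinuousLinearMap.flip_apply, smul_eq_mul,
    map_zero, zero_add, hT, K] at h1 h2 e1 e2 ⊢
  have e1a := e1 (A w)
  have e1b := e1 (S (fderiv ℝ v w))
  have e2a := e2 (A w)
  have e2b := e2 (S (fderiv ℝ u w))
  rw [snd_fderiv_symm hu2 _ T] at e1a e1b
  rw [snd_fderiv_symm hv2 _ T] at e2a e2b
  have hdiag : ∀ l : W →L[ℝ] ℝ, l (S l) = 0 := fun l => by linarith [hS l l]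
  -- Hessian symmetry brings the second-order terms to a common form, in which they cancel (the
  -- Jacobi identity). The instances of `hA` account for the degree of the bracket under the Euler
  -- field.
  rw [e1a, e1b, e2a, e2b, h1, h2, snd_fderiv_symm hu2 (A w) (S (fderiv ℝ H w)),
    snd_fderiv_symm hv2 (A w) (S (fderiv ℝ H w)),
    snd_fderiv_symm hu2 (S (fderiv ℝ v w)) (S (fderiv ℝ H w)),
    snd_fderiv_symm hv2 (S (fderiv ℝ u w)) (S (fderiv ℝ H w)),
    snd_fderiv_symm hH2 (A w) (S (fderiv ℝ u w)), snd_fderiv_symm hH2 (A w) (S (fderiv ℝ v w)),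
    snd_fderiv_symm hH2 (S (fderiv ℝ v w)) (S (fderiv ℝ u w)), hdiag, hdiag,
    eq_add_of_sub_eq (hA (fderiv ℝ u w) (fderiv ℝ H w)),
    eq_add_of_sub_eq (hA (fderiv ℝ v w) (fderiv ℝ H w)),
    hS (fderiv ℝ H w) (fderiv ℝ u w), hS (fderiv ℝ H w) (fderiv ℝ v w)]
  simp only [nsmul_eq_mul, Nat.cast_ofNat, Nat.add_one_sub_one, pow_one]
  field_simp
  ring

end Flat

/-! ### The canonical structure of `ℝⁿ × (ℝⁿ)*` and its invariance under point transformations -/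

section Canonical

variable {n : ℕ}

/-- The covector field `dH` turned into the vector `X_H`, in natural coordinates. -/
def sharp (n : ℕ) : (Model n × (Model n →L[ℝ] ℝ) →L[ℝ] ℝ) →L[ℝ] Model n × (Model n →L[ℝ] ℝ) :=
  ∑ i, ((ContinuousLinearMap.apply ℝ ℝ (dirP i)).smulRight (dirQ i) -
    (ContinuousLinearMap.apply ℝ ℝ (dirQ i)).smulRight (dirP i))

theorem sharp_apply (l : Model n × (Model n →L[ℝ] ℝ) →L[ℝ] ℝ) :
    sharp n l = ∑ i, (l (dirP i) • dirQ i - l (dirQ i) • dirP i) := by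
  rw [sharp, sum_apply]
  rfl

/-- The projection of `ℝⁿ × (ℝⁿ)*` onto the momentum, which is the Euler vector field. -/
def euler (n : ℕ) : Model n × (Model n →L[ℝ] ℝ) →L[ℝ] Model n × (Model n →L[ℝ] ℝ) :=
  (ContinuousLinearMap.inr ℝ _ _).comp (ContinuousLinearMap.snd ℝ _ _)

theorem euler_apply (a : Model n × (Model n →L[ℝ] ℝ)) : euler n a = (0, a.2) := rfl

theorem sum_coord_smul_single (a : Model n) :
    ∑ i, a i • (EuclideanSpace.single i (1 : ℝ) : Model n) = a := by
  simpa using (EuclideanSpace.basisFun (Fin n) ℝ).sum_repr a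

theorem sum_smul_proj (p : Model n →L[ℝ] ℝ) :
    ∑ i, p (EuclideanSpace.single i (1 : ℝ)) • (EuclideanSpace.proj i : Model n →L[ℝ] ℝ) = p := by
  ext a
  conv_rhs => rw [← sum_coord_smul_single a]
  simp [mul_comm]

theorem sum_dir (a : Model n × (Model n →L[ℝ] ℝ)) :
    ∑ i, (a.1 i • dirQ i + a.2 (EuclideanSpace.single i (1 : ℝ)) • dirP i) = a := by
  have h1 := sum_coord_smul_single a.1
  have h2 := sum_smul_proj a.2
  refine Prod.ext ?_ ?_
  · simpa [dirQ, dirP, Prod.fst_sum] using h1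
  · simpa [dirQ, dirP, Prod.snd_sum] using h2

theorem euler_eq_sum (a : Model n × (Model n →L[ℝ] ℝ)) :
    euler n a = ∑ i, a.2 (EuclideanSpace.single i (1 : ℝ)) • dirP i := by
  conv_lhs => rw [← sum_dir (euler n a)]
  simp [euler_apply]

/-- The canonical symplectic form of `ℝⁿ × (ℝⁿ)*`. -/
def symplecticForm (a b : Model n × (Model n →L[ℝ] ℝ)) : ℝ := b.2 a.1 - a.2 b.1

/-- The defining property of a Hamiltonian vector; it trades the coordinate sum for the symplectic
form in everything that follows. -/
theorem symplecticForm_sharp (l : Model n × (Model n →L[ℝ] ℝ) →L[ℝ] ℝ)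
    (a : Model n × (Model n →L[ℝ] ℝ)) : symplecticForm (sharp n l) a = l a := by
  conv_rhs => rw [← sum_dir a]
  rw [symplecticForm, sharp_apply, Prod.fst_sum, Prod.snd_sum, map_sum, map_sum,
    sum_apply, ← Finset.sum_sub_distrib]
  refine Finset.sum_congr rfl fun i _ => ?_
  rw [map_add, map_smul, map_smul]
  simp [dirQ, dirP]
  ring

theorem eq_of_symplecticForm {a b : Model n × (Model n →L[ℝ] ℝ)}
    (h : ∀ c, symplecticForm a c = symplecticForm b c) : a = b := by
  refine Prod.ext ?_ ?_
  · ext i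
    simpa [symplecticForm] using h (0, EuclideanSpace.proj i)
  · ext x
    simpa [symplecticForm] using h (x, 0)

theorem apply_sharp_antisymm (l m : Model n × (Model n →L[ℝ] ℝ) →L[ℝ] ℝ) :
    l (sharp n m) = -m (sharp n l) := by
  rw [← symplecticForm_sharp l, ← symplecticForm_sharp m]
  simp [symplecticForm]

/-- Through the symplectic form, the Euler projection keeps exactly one of the two pairings of
momentum with position in each summand, and their difference is the whole form. This is the
homogeneity of the bracket in the momenta. -/
theorem apply_euler_sharp (l m : Model n × (Model n →L[ℝ] ℝ) →L[ℝ] ℝ) :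
    l (euler n (sharp n m)) - m (euler n (sharp n l)) = l (sharp n m) := by
  rw [← symplecticForm_sharp l, ← symplecticForm_sharp m, ← symplecticForm_sharp l]
  simp only [symplecticForm, euler_apply, map_zero, sub_zero]

/-- A linear map which preserves the symplectic form transforms Hamiltonian vectors into
Hamiltonian vectors. -/
theorem sharp_of_symplectic
    {M : Model n × (Model n →L[ℝ] ℝ) →L[ℝ] Model n × (Model n →L[ℝ] ℝ)}
    (hM : ∀ a b, symplecticForm (M a) (M b) = symplecticForm a b) (hs : Function.Surjective M)
    (l : Model n × (Model n →L[ℝ] ℝ) →L[ℝ] ℝ) : M (sharp n (l.comp M)) = sharp n l := by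
  refine eq_of_symplecticForm fun c => ?_
  obtain ⟨b, rfl⟩ := hs c
  rw [hM, symplecticForm_sharp, symplecticForm_sharp]
  rfl

/-- A point transformation `(x, p) ↦ (f x, p ∘ (Df x)⁻¹)` is symplectic. -/
theorem symplectic_of_pointTransformation {f : Model n → Model n}
    {g : Model n → Model n →L[ℝ] Model n} {x : Model n} (hf : ContDiffAt ℝ 2 f x)
    (hg : DifferentiableAt ℝ g x) (hfg : ∀ᶠ y in 𝓝 x, ∀ a, g y (fderiv ℝ f y a) = a)
    (p : Model n →L[ℝ] ℝ) :
    ∃ M : Model n × (Model n →L[ℝ] ℝ) →L[ℝ] Model n × (Model n →L[ℝ] ℝ),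
      HasFDerivAt (fun b : Model n × (Model n →L[ℝ] ℝ) => (f b.1, b.2.comp (g b.1))) M (x, p) ∧
      (∀ a b, symplecticForm (M a) (M b) = symplecticForm a b) ∧
      (∀ r, M (0, r) = (0, r.comp (g x))) := by
  have hf1 : HasFDerivAt f (fderiv ℝ f x) x := (hf.differentiableAt (by norm_num)).hasFDerivAt
  have hf2 : HasFDerivAt (fderiv ℝ f) (fderiv ℝ (fderiv ℝ f) x) x :=
    ((hf.fderiv_right (m := 1) (by norm_num)).differentiableAt (by norm_num)).hasFDerivAt
  have hfst : HasFDerivAt (Prod.fst : Model n × (Model n →L[ℝ] ℝ) → Model n)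
      (ContinuousLinearMap.fst ℝ (Model n) (Model n →L[ℝ] ℝ)) (x, p) :=
    hasFDerivAt_fst (𝕜 := ℝ)
  have hsnd : HasFDerivAt (Prod.snd : Model n × (Model n →L[ℝ] ℝ) → (Model n →L[ℝ] ℝ))
      (ContinuousLinearMap.snd ℝ (Model n) (Model n →L[ℝ] ℝ)) (x, p) := hasFDerivAt_snd
  have hgc := hg.hasFDerivAt.comp (x, p) hfst
  have hM := (hf1.comp (x, p) hfst).prodMk (hsnd.clm_comp (hgc : HasFDerivAt (fun b : Model n × (Model n →L[ℝ] ℝ) => g b.1) _ (x, p)))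
  -- The derivative of the identity `g ∘ Df = id`. It relates the derivative of `g` to the Hessian
  -- of `f`, whose symmetry then cancels the terms containing `p` in the symplectic form.
  have hinv : ∀ a b, g x (fderiv ℝ (fderiv ℝ f) x b a) + fderiv ℝ g x b (fderiv ℝ f x a) = 0 := by
    intro a b
    have h1 := hg.hasFDerivAt.clm_apply (hf2.clm_apply (hasFDerivAt_const a x))
    have h2 : HasFDerivAt (fun y => g y (fderiv ℝ f y a)) (0 : Model n →L[ℝ] Model n) x :=
      (hasFDerivAt_const a x).congr_of_eventuallyEq (by filter_upwards [hfg] with y hy using hy a)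
    have h3 := DFunLike.congr_fun (h1.unique h2) b
    simpa using h3
  have hsymm : ∀ a b, fderiv ℝ (fderiv ℝ f) x a b = fderiv ℝ (fderiv ℝ f) x b a :=
    (hf.isSymmSndFDerivAt (by simp)).eq
  refine ⟨_, hM, fun a b => ?_, fun r => ?_⟩
  · have h0 := hfg.self_of_nhds
    have h1 := congrArg p (hinv a.1 b.1)
    have h2 := congrArg p (hinv b.1 a.1)
    rw [hsymm] at h2
    simp only [map_add, map_zero] at h1 h2
    simp only [symplecticForm, ContinuousLinearMap.prod_apply, ContinuousLinearMap.comp_apply,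
      add_apply, ContinuousLinearMap.coe_fst', ContinuousLinearMap.coe_snd',
      ContinuousLinearMap.compL_apply, ContinuousLinearMap.flip_apply, Function.comp_apply, h0]
    linarith
  · simp
end Canonical

/-! ### Natural coordinates of `T*Q` -/

section Charts

variable {n : ℕ} {Q : Type*} [TopologicalSpace Q] [ChartedSpace (Model n) Q]
  [IsManifold (𝓡 n) ∞ Q]

/-- The natural chart at `z₀`, with values in `ℝⁿ × (ℝⁿ)*`. -/
abbrev natChart (z₀ : PhaseSpace n Q) :
    PartialEquiv (PhaseSpace n Q) (Model n × (Model n →L[ℝ] ℝ)) :=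
  extChartAt (phaseModel n) z₀

theorem natChart_source (z₀ : PhaseSpace n Q) :
    (natChart z₀).source = {w | w.proj ∈ (extChartAt (𝓡 n) z₀.proj).source} := by
  ext w
  simp only [natChart, FiberBundle.chartedSpace_chartAt, mfld_simps]
  exact ⟨fun h => h.2, fun h => ⟨⟨h, mem_univ _⟩, h⟩⟩

theorem natChart_apply (z₀ w : PhaseSpace n Q) :
    natChart z₀ w = (extChartAt (𝓡 n) z₀.proj w.proj,
      (w.2 : Model n →L[ℝ] ℝ).comp
        ((trivializationAt (Model n) (TangentSpace (𝓡 n)) z₀.proj).symmL ℝ w.proj)) := by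
  rw [natChart, FiberBundle.extChartAt]
  simp only [PartialEquiv.coe_trans, Function.comp_apply, PartialEquiv.prod_coe]
  refine Prod.ext rfl ?_
  ext a
  simp [hom_trivializationAt_apply, ContinuousLinearMap.inCoordinates]

theorem natChart_transition {z₀ z₁ w : PhaseSpace n Q} (h₀ : w ∈ (natChart z₀).source)
    (h₁ : w ∈ (natChart z₁).source) :
    natChart z₀ w = (extChartAt (𝓡 n) z₀.proj w.proj,
      (natChart z₁ w).2.comp (tangentCoordChange (𝓡 n) z₀.proj z₁.proj w.proj)) := by
  rw [natChart_source, mem_ofPred_eq] at h₀ h₁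
  rw [natChart_apply, natChart_apply]
  refine Prod.ext rfl ?_
  ext a
  refine congrArg (w.2 : Model n →L[ℝ] ℝ) ?_
  rw [TangentBundle.symmL_trivializationAt_eq_core (by simpa using h₀),
    TangentBundle.symmL_trivializationAt_eq_core (by simpa using h₁)]
  exact (tangentCoordChange_comp ⟨⟨h₀, h₁⟩, mem_extChartAt_source _⟩).symm

/-- A change of natural charts is the point transformation induced by a change of charts of `Q`,
with the tangent coordinate change in the reverse direction acting on momenta. It is linear in the
momentum, so the Euler vector is carried to the Euler vector. -/
theorem hasFDerivAt_natChart_transition {z₀ z : PhaseSpace n Q}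
    (h : z ∈ (natChart z₀).source) :
    ∃ M : Model n × (Model n →L[ℝ] ℝ) →L[ℝ] Model n × (Model n →L[ℝ] ℝ),
      HasFDerivAt (natChart z₀ ∘ (natChart z).symm) M (natChart z z) ∧
      (∀ a b, symplecticForm (M a) (M b) = symplecticForm a b) ∧
      M (euler n (natChart z z)) = euler n (natChart z₀ z) := by
  set φ := extChartAt (𝓡 n) z.proj with hφ
  set φ₀ := extChartAt (𝓡 n) z₀.proj with hφ₀
  have hz : z ∈ (natChart z).source := mem_extChartAt_source z
  have h₀ : z.proj ∈ φ₀.source := by rwa [natChart_source] at h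
  have hx : (natChart z z).1 = φ z.proj := by rw [natChart_apply]
  have hsrc : φ z.proj ∈ (φ.symm ≫ φ₀).source := by
    rw [PartialEquiv.trans_source'', PartialEquiv.symm_symm, PartialEquiv.symm_target]
    exact mem_image_of_mem _ ⟨mem_extChartAt_source _, h₀⟩
  have hopen : IsOpen (φ.symm ≫ φ₀).source :=
    (continuousOn_extChartAt_symm _).isOpen_inter_preimage (isOpen_extChartAt_target _)
      (isOpen_extChartAt_source _)
  have hf : ContDiffAt ℝ 2 (φ₀ ∘ φ.symm) (φ z.proj) := by
    have := contDiffWithinAt_ext_coord_change (I := 𝓡 n) (n := 2) z₀.proj z.proj hsrc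
    rwa [ModelWithCorners.range_eq_univ, contDiffWithinAt_univ] at this
  have hg' : ContDiffAt ℝ 2 (φ ∘ φ₀.symm) (φ₀ z.proj) := by
    have := contDiffWithinAt_ext_coord_change (I := 𝓡 n) (n := 2) z.proj z₀.proj (y := φ₀ z.proj) (by
      rw [PartialEquiv.trans_source'', PartialEquiv.symm_symm, PartialEquiv.symm_target]
      exact mem_image_of_mem _ ⟨h₀, mem_extChartAt_source _⟩)
    rwa [ModelWithCorners.range_eq_univ, contDiffWithinAt_univ] at this
  have hg : DifferentiableAt ℝ
      (fun x => tangentCoordChange (𝓡 n) z₀.proj z.proj (φ.symm x)) (φ z.proj) := by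
    have h1 : (fun x => tangentCoordChange (𝓡 n) z₀.proj z.proj (φ.symm x)) =
        fderiv ℝ (φ ∘ φ₀.symm) ∘ (φ₀ ∘ φ.symm) := by
      ext1 x
      rw [tangentCoordChange_def, ModelWithCorners.range_eq_univ, fderivWithin_univ]
      rfl
    have h2 : (φ₀ ∘ φ.symm) (φ z.proj) = φ₀ z.proj :=
      congrArg φ₀ (φ.left_inv (mem_extChartAt_source _))
    rw [h1]
    refine DifferentiableAt.comp _ ?_ (hf.differentiableAt (by norm_num))
    rw [h2]
    exact (hg'.fderiv_right (m := 1) (by norm_num)).differentiableAt (by norm_num)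
  have hfg : ∀ᶠ x in 𝓝 (φ z.proj), ∀ a, tangentCoordChange (𝓡 n) z₀.proj z.proj (φ.symm x)
      (fderiv ℝ (φ₀ ∘ φ.symm) x a) = a := by
    filter_upwards [hopen.mem_nhds hsrc] with x hx a
    have hs : φ.symm x ∈ φ.source ∩ φ₀.source := ⟨φ.map_target hx.1, hx.2⟩
    have h1 := hasFDerivWithinAt_tangentCoordChange hs
    rw [ModelWithCorners.range_eq_univ, hasFDerivWithinAt_univ, φ.right_inv hx.1] at h1
    rw [h1.fderiv, tangentCoordChange_comp ⟨hs, hs.1⟩, tangentCoordChange_self hs.1]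
  obtain ⟨M, hM, hM1, hM2⟩ := symplectic_of_pointTransformation hf hg hfg (natChart z z).2
  have hpt : natChart z z = (φ z.proj, (natChart z z).2) := by rw [natChart_apply]
  refine ⟨M, ?_, hM1, ?_⟩
  · rw [hpt]
    refine hM.congr_of_eventuallyEq ?_
    have hev : (natChart z).target ∩ (natChart z).symm ⁻¹' (natChart z₀).source ∈
        𝓝 (natChart z z) :=
      ((continuousOn_extChartAt_symm _).isOpen_inter_preimage (isOpen_extChartAt_target _)
        (isOpen_extChartAt_source _)).mem_nhds ⟨mem_extChartAt_target z, by
          rwa [mem_preimage, extChartAt_to_inv]⟩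
    rw [hpt] at hev
    filter_upwards [hev] with b hb
    have hw := (natChart z).map_target hb.1
    have hbw : b = natChart z ((natChart z).symm b) := ((natChart z).right_inv hb.1).symm
    have h1 : φ.symm b.1 = ((natChart z).symm b).proj := by
      conv_lhs => rw [hbw, natChart_apply]
      rw [natChart_source] at hw
      exact φ.left_inv hw
    rw [Function.comp_apply, Function.comp_apply, h1, natChart_transition hb.2 hw, ← hbw]
  · rw [euler_apply, euler_apply, hM2, natChart_transition h hz, φ.left_inv (mem_extChartAt_source _)]

/-- The derivative of the natural chart at `z₀`, with respect to the natural coordinates at `z`. -/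
def chartDeriv (z₀ z : PhaseSpace n Q) :
    Model n × (Model n →L[ℝ] ℝ) →L[ℝ] Model n × (Model n →L[ℝ] ℝ) :=
  mfderiv (phaseModel n) 𝓘(ℝ, Model n × (Model n →L[ℝ] ℝ)) (natChart z₀) z

theorem chartDeriv_eq_fderiv {z₀ z : PhaseSpace n Q} (h : z ∈ (natChart z₀).source) :
    chartDeriv z₀ z = fderiv ℝ (natChart z₀ ∘ (natChart z).symm) (natChart z z) := by
  have hd : MDifferentiableAt (phaseModel n) 𝓘(ℝ, Model n × (Model n →L[ℝ] ℝ)) (natChart z₀) z :=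
    mdifferentiableAt_extChartAt (by simpa using h)
  rw [chartDeriv, hd.mfderiv]
  simp [writtenInExtChartAt]
  rfl

theorem chartDeriv_symplectic {z₀ z : PhaseSpace n Q} (h : z ∈ (natChart z₀).source)
    (a b : Model n × (Model n →L[ℝ] ℝ)) :
    symplecticForm (chartDeriv z₀ z a) (chartDeriv z₀ z b) = symplecticForm a b := by
  obtain ⟨M, hM, hM1, -⟩ := hasFDerivAt_natChart_transition h
  rw [chartDeriv_eq_fderiv h, hM.fderiv, hM1]

theorem chartDeriv_euler {z₀ z : PhaseSpace n Q} (h : z ∈ (natChart z₀).source) :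
    chartDeriv z₀ z (euler n (natChart z z)) = euler n (natChart z₀ z) := by
  obtain ⟨M, hM, -, hM2⟩ := hasFDerivAt_natChart_transition h
  rw [chartDeriv_eq_fderiv h, hM.fderiv, hM2]

theorem chartDeriv_sharp {z₀ z : PhaseSpace n Q} (h : z ∈ (natChart z₀).source)
    (l : Model n × (Model n →L[ℝ] ℝ) →L[ℝ] ℝ) :
    chartDeriv z₀ z (sharp n (l.comp (chartDeriv z₀ z))) = sharp n l := by
  refine sharp_of_symplectic (chartDeriv_symplectic h) ?_ l
  -- Preservation of a nondegenerate form gives injectivity, and equal finite dimensions then give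
  -- surjectivity.
  have hinj : Function.Injective (chartDeriv z₀ z).toLinearMap := by
    intro a b hab
    refine eq_of_symplecticForm fun c => ?_
    rw [← chartDeriv_symplectic h a c, ← chartDeriv_symplectic h b c]
    exact congrArg (symplecticForm · _) hab
  exact LinearMap.injective_iff_surjective.1 hinj

/-- The chain rule for a function which is given in the natural chart at `z₀`. -/
theorem hasMFDerivAt_of_natChart {V : Type*} [NormedAddCommGroup V] [NormedSpace ℝ V]
    {F : PhaseSpace n Q → V} {G : Model n × (Model n →L[ℝ] ℝ) → V} {z₀ z : PhaseSpace n Q}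
    (h : z ∈ (natChart z₀).source) (hFG : ∀ w ∈ (natChart z₀).source, F w = G (natChart z₀ w))
    (hG : DifferentiableAt ℝ G (natChart z₀ z)) :
    HasMFDerivAt (phaseModel n) 𝓘(ℝ, V) F z
      ((fderiv ℝ G (natChart z₀ z)).comp (chartDeriv z₀ z)) := by
  have hd : MDifferentiableAt (phaseModel n) 𝓘(ℝ, Model n × (Model n →L[ℝ] ℝ)) (natChart z₀) z :=
    mdifferentiableAt_extChartAt (by simpa using h)
  refine (hG.hasFDerivAt.hasMFDerivAt.comp z hd.hasMFDerivAt).congr_of_eventuallyEq ?_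
  filter_upwards [(isOpen_extChartAt_source z₀).mem_nhds h] with w hw using hFG w hw

end Charts

/-! ### Brackets and densities in natural coordinates -/

section Coordinates

variable {n : ℕ} {Q : Type*} [TopologicalSpace Q] [ChartedSpace (Model n) Q]
  [IsManifold (𝓡 n) ∞ Q]

/-- The extended phase space `ℝⁿ × (ℝⁿ)* × ℝ` in natural coordinates. -/
abbrev ExtModel (n : ℕ) : Type := (Model n × (Model n →L[ℝ] ℝ)) × ℝ

/-- The canonical Poisson tensor on the extended phase space. -/
def extSharp (n : ℕ) : (ExtModel n →L[ℝ] ℝ) →L[ℝ] ExtModel n :=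
  (ContinuousLinearMap.inl ℝ _ ℝ).comp ((sharp n).comp
    ((ContinuousLinearMap.compL ℝ (Model n × (Model n →L[ℝ] ℝ)) (ExtModel n) ℝ).flip
      (ContinuousLinearMap.inl ℝ _ ℝ)))

theorem extSharp_apply (l : ExtModel n →L[ℝ] ℝ) :
    extSharp n l = (sharp n (l.comp (ContinuousLinearMap.inl ℝ _ ℝ)), 0) := rfl

/-- The Euler field on the extended phase space. -/
def extEuler (n : ℕ) : ExtModel n →L[ℝ] ExtModel n :=
  (ContinuousLinearMap.inl ℝ _ ℝ).comp ((euler n).comp (ContinuousLinearMap.fst ℝ _ ℝ))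

theorem extEuler_apply (a : ExtModel n) : extEuler n a = (euler n a.1, 0) := rfl

/-- The time direction of the extended phase space. -/
def timeDir (n : ℕ) : ExtModel n := (0, 1)

theorem extEuler_timeDir : extEuler n (timeDir n) = 0 := by
  simp [extEuler_apply, timeDir]

theorem apply_extSharp_antisymm (l m : ExtModel n →L[ℝ] ℝ) :
    l (extSharp n m) = -m (extSharp n l) :=
  apply_sharp_antisymm (l.comp (ContinuousLinearMap.inl ℝ _ ℝ))
    (m.comp (ContinuousLinearMap.inl ℝ _ ℝ))

theorem apply_extEuler_extSharp (l m : ExtModel n →L[ℝ] ℝ) :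
    l (extEuler n (extSharp n m)) - m (extEuler n (extSharp n l)) = l (extSharp n m) :=
  apply_euler_sharp (l.comp (ContinuousLinearMap.inl ℝ _ ℝ))
    (m.comp (ContinuousLinearMap.inl ℝ _ ℝ))

/-- The time-dependent function `F` on `T*Q` is given by `f` in the natural chart at `z₀`. -/
def ReadsAs {V : Type*} (z₀ : PhaseSpace n Q) (t : ℝ) (F : PhaseSpace n Q → V)
    (f : ExtModel n → V) : Prop :=
  ∀ w ∈ (natChart z₀).source, F w = f (natChart z₀ w, t)

/-! ### Derivatives of functions given in a fixed natural chart. -/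

section ReadsAs

variable {V : Type*} [NormedAddCommGroup V] [NormedSpace ℝ V]
  {z₀ z : PhaseSpace n Q} {t : ℝ}

theorem hasMFDerivAt_of_readsAs (h : z ∈ (natChart z₀).source)
    {F : PhaseSpace n Q → V} {f : ExtModel n → V} (hF : ReadsAs z₀ t F f)
    (hf : DifferentiableAt ℝ f (natChart z₀ z, t)) :
    HasMFDerivAt (phaseModel n) 𝓘(ℝ, V) F z
      (((fderiv ℝ f (natChart z₀ z, t)).comp (ContinuousLinearMap.inl ℝ _ ℝ)).comp
        (chartDeriv z₀ z)) := by
  have h1 : HasFDerivAt (fun e => f (e, t))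
      ((fderiv ℝ f (natChart z₀ z, t)).comp (ContinuousLinearMap.inl ℝ _ ℝ)) (natChart z₀ z) :=
    hf.hasFDerivAt.comp (natChart z₀ z) (hasFDerivAt_prodMk_left _ t)
  rw [← h1.fderiv]
  exact hasMFDerivAt_of_natChart h (G := fun e => f (e, t)) hF h1.differentiableAt

theorem dirDeriv_of_readsAs (h : z ∈ (natChart z₀).source)
    {F : PhaseSpace n Q → V} {f : ExtModel n → V} (hF : ReadsAs z₀ t F f)
    (hf : DifferentiableAt ℝ f (natChart z₀ z, t)) (v : Model n × (Model n →L[ℝ] ℝ)) :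
    dirDeriv v F z = fderiv ℝ f (natChart z₀ z, t) (chartDeriv z₀ z v, 0) := by
  rw [dirDeriv, (hasMFDerivAt_of_readsAs h hF hf).mfderiv]
  rfl

theorem hasDerivAt_of_extModel {f : ExtModel n → V} {e : Model n × (Model n →L[ℝ] ℝ)}
    (hf : DifferentiableAt ℝ f (e, t)) :
    HasDerivAt (fun s => f (e, s)) (fderiv ℝ f (e, t) (timeDir n)) t := by
  have h1 : HasFDerivAt (fun s => f (e, s))
      ((fderiv ℝ f (e, t)).comp (ContinuousLinearMap.inr ℝ _ ℝ)) t :=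
    hf.hasFDerivAt.comp t (hasFDerivAt_prodMk_right e t)
  exact h1.hasDerivAt

end ReadsAs

/-! ### Real brackets and Euler derivatives in a fixed natural chart. -/

section Real

variable {z₀ z : PhaseSpace n Q} {t : ℝ}

theorem poisson_eq_apply_sharp (F G : PhaseSpace n Q → ℝ) (z : PhaseSpace n Q)
    {l m : Model n × (Model n →L[ℝ] ℝ) →L[ℝ] ℝ} (hl : ∀ v, dirDeriv v F z = l v)
    (hm : ∀ v, dirDeriv v G z = m v) : poisson F G z = l (sharp n m) := by
  simp only [poisson, partialQ, partialP, hl, hm, sharp_apply, map_sum, map_sub, map_smul,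
    smul_eq_mul]
  exact Finset.sum_congr rfl fun i _ => by ring

/-- The bracket at `z` is formed in the chart belonging to `z`; it agrees with the one in the chart
at `z₀` because the chart derivative is symplectic. -/
theorem poisson_of_readsAs (h : z ∈ (natChart z₀).source)
    {F G : PhaseSpace n Q → ℝ} {f g : ExtModel n → ℝ} (hF : ReadsAs z₀ t F f)
    (hf : DifferentiableAt ℝ f (natChart z₀ z, t)) (hG : ReadsAs z₀ t G g)
    (hg : DifferentiableAt ℝ g (natChart z₀ z, t)) :
    poisson F G z = flatBracket (extSharp n) f g (natChart z₀ z, t) := by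
  rw [poisson_eq_apply_sharp F G z
    (l := ((fderiv ℝ f (natChart z₀ z, t)).comp (ContinuousLinearMap.inl ℝ _ ℝ)).comp
        (chartDeriv z₀ z))
    (m := ((fderiv ℝ g (natChart z₀ z, t)).comp (ContinuousLinearMap.inl ℝ _ ℝ)).comp
        (chartDeriv z₀ z)) (dirDeriv_of_readsAs h hF hf) (dirDeriv_of_readsAs h hG hg),
    ContinuousLinearMap.comp_apply, chartDeriv_sharp h]
  rfl

theorem sum_momentum_mul_partialP_of_readsAs (h : z ∈ (natChart z₀).source)
    {F : PhaseSpace n Q → ℝ} {f : ExtModel n → ℝ} (hF : ReadsAs z₀ t F f)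
    (hf : DifferentiableAt ℝ f (natChart z₀ z, t)) :
    ∑ i, momentum z i z * partialP i F z =
      linearFieldDeriv (extEuler n) f (natChart z₀ z, t) := by
  have h1 : ∀ v, partialP v F z = (((fderiv ℝ f (natChart z₀ z, t)).comp
      (ContinuousLinearMap.inl ℝ _ ℝ)).comp (chartDeriv z₀ z)) (dirP v) :=
    fun i => dirDeriv_of_readsAs h hF hf (dirP i)
  simp only [h1, momentum, ← smul_eq_mul, ← map_smul, ← map_sum]
  rw [← euler_eq_sum, ContinuousLinearMap.comp_apply, chartDeriv_euler h]
  rfl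

theorem chartDeriv_self (z : PhaseSpace n Q) :
    chartDeriv z z = ContinuousLinearMap.id ℝ (Model n × (Model n →L[ℝ] ℝ)) := by
  rw [chartDeriv_eq_fderiv (mem_extChartAt_source z)]
  refine ((hasFDerivAt_id (natChart z z)).congr_of_eventuallyEq ?_).fderiv
  filter_upwards [extChartAt_target_mem_nhds z] with e he using (natChart z).right_inv he

theorem hasMFDerivAt_momentum (z : PhaseSpace n Q) (i : Fin n) :
    HasMFDerivAt (phaseModel n) 𝓘(ℝ, ℝ) (momentum z i) z
      ((ContinuousLinearMap.apply ℝ ℝ (EuclideanSpace.single i (1 : ℝ))).comp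
        (ContinuousLinearMap.snd ℝ (Model n) (Model n →L[ℝ] ℝ))) := by
  set l := (ContinuousLinearMap.apply ℝ ℝ (EuclideanSpace.single i (1 : ℝ))).comp
        (ContinuousLinearMap.snd ℝ (Model n) (Model n →L[ℝ] ℝ))
  have h1 := hasMFDerivAt_of_natChart (F := momentum z i) (G := l) (mem_extChartAt_source z)
    (fun _ _ => rfl) l.differentiableAt
  rwa [chartDeriv_self, l.fderiv] at h1

/-- Leibniz rule: each ∂pᵢ/∂pᵢ contributes one copy of `F`. This `n` is the source of the
coefficient `1 + n` in the flat density. -/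
theorem sum_partialP_momentum_mul {F : PhaseSpace n Q → ℝ}
    (hF : MDifferentiableAt (phaseModel n) 𝓘(ℝ, ℝ) F z) :
    ∑ i, partialP i (fun w => momentum z i w * F w) z =
      n * F z + ∑ i, momentum z i z * partialP i F z := by
  have h1 : ∀ i, partialP i (fun w => momentum z i w * F w) z =
      F z + momentum z i z * partialP i F z := by
    intro i
    have h2 := ((hasMFDerivAt_momentum z i).mul hF.hasMFDerivAt).mfderiv
    refine (DFunLike.congr_fun h2 (dirP i)).trans ?_
    change momentum z i z * partialP i F z +
      F z * (EuclideanSpace.proj i : Model n →L[ℝ] ℝ) (EuclideanSpace.single i 1) = _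
    simp [add_comm]
  rw [Finset.sum_congr rfl fun i _ => h1 i, Finset.sum_add_distrib]
  simp

end Real

/-! ### Splitting wave functions into real and imaginary parts. -/

section Complex

variable {z₀ z : PhaseSpace n Q} {t : ℝ}

theorem dirDeriv_clm_comp {V V' : Type*} [NormedAddCommGroup V] [NormedSpace ℝ V]
    [NormedAddCommGroup V'] [NormedSpace ℝ V'] (l : V →L[ℝ] V') {F : PhaseSpace n Q → V}
    (hF : MDifferentiableAt (phaseModel n) 𝓘(ℝ, V) F z) (v : Model n × (Model n →L[ℝ] ℝ)) :
    dirDeriv v (fun w => l (F w)) z = l (dirDeriv v F z) := by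
  have h1 := (l.hasFDerivAt.hasMFDerivAt.comp z hF.hasMFDerivAt).mfderiv
  have h2 : (fun w => l (F w)) = l ∘ F := rfl
  unfold dirDeriv
  rw [h2, h1]
  rfl

theorem poisson_ofReal_left {H : PhaseSpace n Q → ℝ} {Ψ : PhaseSpace n Q → ℂ}
    (hH : MDifferentiableAt (phaseModel n) 𝓘(ℝ, ℝ) H z)
    (hΨ : MDifferentiableAt (phaseModel n) 𝓘(ℝ, ℂ) Ψ z) :
    poisson (fun w => (H w : ℂ)) Ψ z =
      (poisson H (fun w => (Ψ w).re) z : ℝ) + (poisson H (fun w => (Ψ w).im) z : ℝ) * Complex.I := by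
  have h1 : ∀ v, dirDeriv v (fun w => (H w : ℂ)) z = (dirDeriv v H z : ℝ) :=
    dirDeriv_clm_comp Complex.ofRealCLM hH
  have h2 : ∀ v, dirDeriv v (fun w => (Ψ w).re) z = (dirDeriv v Ψ z).re :=
    dirDeriv_clm_comp Complex.reCLM hΨ
  have h3 : ∀ v, dirDeriv v (fun w => (Ψ w).im) z = (dirDeriv v Ψ z).im :=
    dirDeriv_clm_comp Complex.imCLM hΨ
  apply Complex.ext <;> simp [poisson, h1, h2, h3]

/-- For Ψ = u + iv, bilinearity and antisymmetry give {Ψ, Ψ̄} = -2i{u, v}. -/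
theorem re_I_mul_poisson_conj (ħ : ℝ) {Ψ : PhaseSpace n Q → ℂ}
    (hΨ : MDifferentiableAt (phaseModel n) 𝓘(ℝ, ℂ) Ψ z) :
    (Complex.I * ħ * poisson Ψ (fun w => conj (Ψ w)) z).re =
      2 * ħ * poisson (fun w => (Ψ w).re) (fun w => (Ψ w).im) z := by
  have h1 : ∀ v, dirDeriv v (fun w => conj (Ψ w)) z = conj (dirDeriv v Ψ z) :=
    dirDeriv_clm_comp (Complex.conjCLE : ℂ →L[ℝ] ℂ) hΨ
  have h2 : ∀ v, dirDeriv v (fun w => (Ψ w).re) z = (dirDeriv v Ψ z).re :=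
    dirDeriv_clm_comp Complex.reCLM hΨ
  have h3 : ∀ v, dirDeriv v (fun w => (Ψ w).im) z = (dirDeriv v Ψ z).im :=
    dirDeriv_clm_comp Complex.imCLM hΨ
  have h4 : (poisson Ψ (fun w => conj (Ψ w)) z).im =
      -2 * poisson (fun w => (Ψ w).re) (fun w => (Ψ w).im) z := by
    simp only [poisson, partialQ, partialP, h1, h2, h3, Complex.im_sum, Finset.mul_sum]
    refine Finset.sum_congr rfl fun i _ => ?_
    simp only [Complex.sub_im, Complex.mul_im, Complex.conj_re, Complex.conj_im]
    ring
  have h5 : (Complex.I * ħ * poisson Ψ (fun w => conj (Ψ w)) z).re =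
      -ħ * (poisson Ψ (fun w => conj (Ψ w)) z).im := by
    simp
  rw [h5, h4]
  ring

/-- The density in natural coordinates. -/
theorem density_of_readsAs (ħ : ℝ) (h : z ∈ (natChart z₀).source) {Ψ : PhaseSpace n Q → ℂ}
    {u v : ExtModel n → ℝ} (hΨ : MDifferentiableAt (phaseModel n) 𝓘(ℝ, ℂ) Ψ z)
    (hu : ReadsAs z₀ t (fun w => (Ψ w).re) u) (hv : ReadsAs z₀ t (fun w => (Ψ w).im) v)
    (hud : DifferentiableAt ℝ u (natChart z₀ z, t))
    (hvd : DifferentiableAt ℝ v (natChart z₀ z, t)) :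
    density ħ Ψ z = flatDensity (extSharp n) (extEuler n) (1 + n) ħ u v (natChart z₀ z, t) := by
  have hn : ∀ w, ‖Ψ w‖ ^ 2 = (Ψ w).re ^ 2 + (Ψ w).im ^ 2 := fun w => by
    rw [← Complex.normSq_eq_norm_sq, Complex.normSq_apply]; ring
  have hρ : ReadsAs z₀ t (fun w => ‖Ψ w‖ ^ 2) (fun e => u e ^ 2 + v e ^ 2) := fun w hw => by
    simp only [hn, ← hu w hw, ← hv w hw]
  have hρd := (hud.hasFDerivAt.pow 2).add (hvd.hasFDerivAt.pow 2)
  have hρd' : HasFDerivAt (fun e => u e ^ 2 + v e ^ 2) _ _ := hρd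
  rw [density, re_I_mul_poisson_conj ħ hΨ, poisson_of_readsAs h hu hud hv hvd,
    sum_partialP_momentum_mul (hasMFDerivAt_of_readsAs h hρ hρd'.differentiableAt).mdifferentiableAt,
    sum_momentum_mul_partialP_of_readsAs h hρ hρd'.differentiableAt,
    show ‖Ψ z‖ ^ 2 = _ from hρ z h, flatDensity,
    linearFieldDeriv, hρd'.fderiv]
  simp [linearFieldDeriv]
  ring

/-- The Koopman-van Hove equation at a point, in natural coordinates. -/
theorem flatKvHAt_iff {ħ : ℝ} (hħ : ħ ≠ 0) (h : z ∈ (natChart z₀).source)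
    {H : PhaseSpace n Q → ℝ} {Ψ : PhaseSpace n Q → ℝ → ℂ} {k u v : ExtModel n → ℝ}
    (hΨ : MDifferentiableAt (phaseModel n) 𝓘(ℝ, ℂ) (fun w => Ψ w t) z)
    (hΨt : DifferentiableAt ℝ (Ψ z) t)
    (hk : ReadsAs z₀ t H k)
    (hu : ∀ᶠ s in 𝓝 t, ReadsAs z₀ s (fun w => (Ψ w s).re) u)
    (hv : ∀ᶠ s in 𝓝 t, ReadsAs z₀ s (fun w => (Ψ w s).im) v)
    (hkd : DifferentiableAt ℝ k (natChart z₀ z, t))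
    (hud : DifferentiableAt ℝ u (natChart z₀ z, t))
    (hvd : DifferentiableAt ℝ v (natChart z₀ z, t)) :
    FlatKvHAt (extSharp n) (extEuler n) (timeDir n) ħ k u v (natChart z₀ z, t) ↔
      Complex.I * ħ * deriv (Ψ z) t = covariantLiouvillian ħ H (fun w => Ψ w t) z := by
  have hu' := hu.self_of_nhds
  have hv' := hv.self_of_nhds
  have h1 : fderiv ℝ u (natChart z₀ z, t) (timeDir n) = (deriv (Ψ z) t).re := by
    refine (hasDerivAt_of_extModel hud).unique ?_
    refine (Complex.reCLM.hasFDerivAt.comp_hasDerivAt t hΨt.hasDerivAt).congr_of_eventuallyEq ?_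
    filter_upwards [hu] with s hs using (hs z h).symm
  have h2 : fderiv ℝ v (natChart z₀ z, t) (timeDir n) = (deriv (Ψ z) t).im := by
    refine (hasDerivAt_of_extModel hvd).unique ?_
    refine (Complex.imCLM.hasFDerivAt.comp_hasDerivAt t hΨt.hasDerivAt).congr_of_eventuallyEq ?_
    filter_upwards [hv] with s hs using (hs z h).symm
  rw [covariantLiouvillian,
    poisson_ofReal_left (hasMFDerivAt_of_readsAs h hk hkd).mdifferentiableAt hΨ,
    poisson_of_readsAs h hk hkd hu' hud, poisson_of_readsAs h hk hkd hv' hvd, liouvilleTerm,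
    sum_momentum_mul_partialP_of_readsAs h hk hkd, hk z h, FlatKvHAt, h1, h2, ← hu' z h, ← hv' z h,
    Complex.ext_iff]
  simp only [Complex.mul_re, Complex.mul_im, Complex.I_re, Complex.I_im, Complex.ofReal_re,
    Complex.ofReal_im, Complex.sub_re, Complex.sub_im, Complex.add_re, Complex.add_im]
  constructor
  · rintro ⟨h3, h4⟩
    rw [h3, h4]
    constructor <;> (field_simp; ring)
  · rintro ⟨h3, h4⟩
    constructor
    · field_simp
      linarith
    · field_simp
      linarith

end Complex

end Coordinates

/-! ### Classical solutions of the Koopman-van Hove equation -/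

section Solutions

variable {n : ℕ} {Q : Type*} [TopologicalSpace Q] [ChartedSpace (Model n) Q]
  [IsManifold (𝓡 n) ∞ Q]

/-- A time-dependent function on `T*Q`, written in the natural chart at `z₀`. -/
def readIn {V : Type*} (z₀ : PhaseSpace n Q) (F : PhaseSpace n Q → ℝ → V) (a : ExtModel n) : V :=
  F ((natChart z₀).symm a.1) a.2

theorem readsAs_readIn {V : Type*} (z₀ : PhaseSpace n Q) (F : PhaseSpace n Q → ℝ → V) (t : ℝ) :
    ReadsAs z₀ t (fun w => F w t) (readIn z₀ F) := fun w hw => by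
  simp only [readIn, (natChart z₀).left_inv hw]

/-- The part of the extended phase space which is covered by the natural chart at `z₀`. -/
def extTarget (z₀ : PhaseSpace n Q) (J : Set ℝ) : Set (ExtModel n) := (natChart z₀).target ×ˢ J

theorem isOpen_extTarget (z₀ : PhaseSpace n Q) {J : Set ℝ} (hJ : IsOpen J) :
    IsOpen (extTarget z₀ J) := (isOpen_extChartAt_target z₀).prod hJ

theorem mem_extTarget {z₀ z : PhaseSpace n Q} (h : z ∈ (natChart z₀).source) {J : Set ℝ} {t : ℝ}
    (ht : t ∈ J) : (natChart z₀ z, t) ∈ extTarget z₀ J := ⟨(natChart z₀).map_source h, ht⟩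

theorem contDiffOn_readIn {V : Type*} [NormedAddCommGroup V] [NormedSpace ℝ V]
    (z₀ : PhaseSpace n Q) {J : Set ℝ} {F : PhaseSpace n Q → ℝ → V}
    (hF : ContMDiffOn ((phaseModel n).prod 𝓘(ℝ, ℝ)) 𝓘(ℝ, V) 2
      (fun zt : PhaseSpace n Q × ℝ => F zt.1 zt.2) (univ ×ˢ J)) :
    ContDiffOn ℝ 2 (readIn z₀ F) (extTarget z₀ J) := by
  have h1 : ContMDiffOn 𝓘(ℝ, Model n × (Model n →L[ℝ] ℝ)) (phaseModel n) 2
      (natChart z₀).symm (natChart z₀).target := contMDiffOn_extChartAt_symm z₀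
  have h2 := h1.prodMap (contMDiffOn_id (I := 𝓘(ℝ, ℝ)) (n := 2) (s := J))
  have h3 := hF.comp h2 fun a ha => ⟨mem_univ _, ha.2⟩
  rw [← contMDiffOn_iff_contDiffOn, modelWithCornersSelf_prod, ← chartedSpaceSelf_prod]
  exact h3

theorem contDiffOn_re {W : Type*} [NormedAddCommGroup W] [NormedSpace ℝ W] {f : W → ℂ} {U : Set W}
    (hf : ContDiffOn ℝ 2 f U) : ContDiffOn ℝ 2 (fun a => (f a).re) U :=
  Complex.reCLM.contDiff.comp_contDiffOn hf

theorem contDiffOn_im {W : Type*} [NormedAddCommGroup W] [NormedSpace ℝ W] {f : W → ℂ} {U : Set W}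
    (hf : ContDiffOn ℝ 2 f U) : ContDiffOn ℝ 2 (fun a => (f a).im) U :=
  Complex.imCLM.contDiff.comp_contDiffOn hf

theorem contMDiffOn_autonomous {H : PhaseSpace n Q → ℝ} (J : Set ℝ)
    (hH : ContMDiff (phaseModel n) 𝓘(ℝ, ℝ) 2 H) :
    ContMDiffOn ((phaseModel n).prod 𝓘(ℝ, ℝ)) 𝓘(ℝ, ℝ) 2
      (fun zt : PhaseSpace n Q × ℝ => H zt.1) (univ ×ˢ J) :=
  (hH.comp contMDiff_fst).contMDiffOn

variable {J : Set ℝ} {H : PhaseSpace n Q → ℝ} {Ψ : PhaseSpace n Q → ℝ → ℂ} {ħ : ℝ}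

theorem differentiableAt_readIn (hJ : IsOpen J) {V : Type*} [NormedAddCommGroup V]
    [NormedSpace ℝ V] {F : PhaseSpace n Q → ℝ → V}
    (hF : ContMDiffOn ((phaseModel n).prod 𝓘(ℝ, ℝ)) 𝓘(ℝ, V) 2
      (fun zt : PhaseSpace n Q × ℝ => F zt.1 zt.2) (univ ×ˢ J))
    {z₀ z : PhaseSpace n Q} (h : z ∈ (natChart z₀).source) {t : ℝ} (ht : t ∈ J) :
    DifferentiableAt ℝ (readIn z₀ F) (natChart z₀ z, t) :=
  ((contDiffOn_readIn z₀ hF).contDiffAt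
    ((isOpen_extTarget z₀ hJ).mem_nhds (mem_extTarget h ht))).differentiableAt (by norm_num)

theorem mdifferentiableAt_of_contMDiffOn (hJ : IsOpen J) {V : Type*} [NormedAddCommGroup V]
    [NormedSpace ℝ V] {F : PhaseSpace n Q → ℝ → V}
    (hF : ContMDiffOn ((phaseModel n).prod 𝓘(ℝ, ℝ)) 𝓘(ℝ, V) 2
      (fun zt : PhaseSpace n Q × ℝ => F zt.1 zt.2) (univ ×ˢ J))
    (z : PhaseSpace n Q) {t : ℝ} (ht : t ∈ J) :
    MDifferentiableAt (phaseModel n) 𝓘(ℝ, V) (fun w => F w t) z :=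
  (hasMFDerivAt_of_readsAs (mem_extChartAt_source z) (readsAs_readIn z F t)
    (differentiableAt_readIn hJ hF (mem_extChartAt_source z) ht)).mdifferentiableAt

theorem differentiableAt_time_of_contMDiffOn (hJ : IsOpen J) {V : Type*} [NormedAddCommGroup V]
    [NormedSpace ℝ V] {F : PhaseSpace n Q → ℝ → V}
    (hF : ContMDiffOn ((phaseModel n).prod 𝓘(ℝ, ℝ)) 𝓘(ℝ, V) 2
      (fun zt : PhaseSpace n Q × ℝ => F zt.1 zt.2) (univ ×ˢ J))
    (z : PhaseSpace n Q) {t : ℝ} (ht : t ∈ J) :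
    DifferentiableAt ℝ (F z) t := by
  have h1 := (hasDerivAt_of_extModel
    (differentiableAt_readIn hJ hF (mem_extChartAt_source z) ht)).differentiableAt
  have h2 : (fun s => readIn z F (natChart z z, s)) = F z :=
    funext fun s => (readsAs_readIn z F s z (mem_extChartAt_source z)).symm
  rwa [h2] at h1

/-- The Koopman-van Hove equation in the natural chart at `z₀`. -/
theorem flatKvHAt_readIn_iff (hħ : ħ ≠ 0) (hJ : IsOpen J)
    (hH : ContMDiff (phaseModel n) 𝓘(ℝ, ℝ) 2 H)
    (hΨ : ContMDiffOn ((phaseModel n).prod 𝓘(ℝ, ℝ)) 𝓘(ℝ, ℂ) 2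
      (fun zt : PhaseSpace n Q × ℝ => Ψ zt.1 zt.2) (univ ×ˢ J))
    {z₀ z : PhaseSpace n Q} (h : z ∈ (natChart z₀).source) {t : ℝ} (ht : t ∈ J) :
    FlatKvHAt (extSharp n) (extEuler n) (timeDir n) ħ (readIn z₀ fun w _ => H w)
        (fun a => (readIn z₀ Ψ a).re) (fun a => (readIn z₀ Ψ a).im) (natChart z₀ z, t) ↔
      Complex.I * ħ * deriv (Ψ z) t = covariantLiouvillian ħ H (fun w => Ψ w t) z := by
  have hd := differentiableAt_readIn hJ hΨ h ht
  exact flatKvHAt_iff hħ h (mdifferentiableAt_of_contMDiffOn hJ hΨ z ht)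
    (differentiableAt_time_of_contMDiffOn hJ hΨ z ht) (readsAs_readIn z₀ (fun w _ => H w) t)
    (.of_forall fun s w hw => congrArg Complex.re (readsAs_readIn z₀ Ψ s w hw))
    (.of_forall fun s w hw => congrArg Complex.im (readsAs_readIn z₀ Ψ s w hw))
    (differentiableAt_readIn hJ (contMDiffOn_autonomous J hH) h ht)
    (Complex.reCLM.differentiableAt.comp _ hd) (Complex.imCLM.differentiableAt.comp _ hd)

theorem continuousOn_flatBracket {W : Type*} [NormedAddCommGroup W] [NormedSpace ℝ W]
    (S : (W →L[ℝ] ℝ) →L[ℝ] W) {F G : W → ℝ} {U : Set W} (hU : IsOpen U)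
    (hF : ContDiffOn ℝ 2 F U) (hG : ContDiffOn ℝ 2 G U) :
    ContinuousOn (flatBracket S F G) U :=
  (hF.continuousOn_fderiv_of_isOpen hU (by norm_num)).clm_apply
    (S.continuous.comp_continuousOn (hG.continuousOn_fderiv_of_isOpen hU (by norm_num)))

theorem continuousOn_linearFieldDeriv {W : Type*} [NormedAddCommGroup W] [NormedSpace ℝ W]
    (A : W →L[ℝ] W) {F : W → ℝ} {U : Set W} (hU : IsOpen U) (hF : ContDiffOn ℝ 2 F U) :
    ContinuousOn (linearFieldDeriv A F) U :=
  (hF.continuousOn_fderiv_of_isOpen hU (by norm_num)).clm_apply A.continuous.continuousOn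

/-- The Koopman-van Hove equation is a closed condition. -/
theorem flatKvHAt_of_frequently {W : Type*} [NormedAddCommGroup W] [NormedSpace ℝ W]
    {S : (W →L[ℝ] ℝ) →L[ℝ] W} {A : W →L[ℝ] W} {T : W} {k u v : W → ℝ} {U : Set W} (hU : IsOpen U)
    (hk : ContDiffOn ℝ 2 k U) (hu : ContDiffOn ℝ 2 u U) (hv : ContDiffOn ℝ 2 v U)
    {w : W} (hw : w ∈ U) (h : ∃ᶠ a in 𝓝 w, FlatKvHAt S A T ħ k u v a) :
    FlatKvHAt S A T ħ k u v w := by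
  have hL := (continuousOn_linearFieldDeriv A hU hk).sub hk.continuousOn
  have e1 := ((hu.continuousOn_fderiv_of_isOpen hU (by norm_num)).clm_apply
    (continuousOn_const (c := T))).sub ((continuousOn_flatBracket S hU hk hu).sub
      ((hL.mul hv.continuousOn).const_smul ħ⁻¹))
  have e2 := ((hv.continuousOn_fderiv_of_isOpen hU (by norm_num)).clm_apply
    (continuousOn_const (c := T))).sub ((continuousOn_flatBracket S hU hk hv).add
      ((hL.mul hu.continuousOn).const_smul ħ⁻¹))
  have key : ∀ {f : W → ℝ}, ContinuousOn f U → (∃ᶠ a in 𝓝 w, f a = 0) → f w = 0 := by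
    intro f hf hfr
    by_contra hne
    exact hfr ((hf.continuousAt (hU.mem_nhds hw)).eventually_ne hne)
  exact ⟨sub_eq_zero.1 (key e1 (h.mono fun a ha => sub_eq_zero.2 ha.1)),
    sub_eq_zero.1 (key e2 (h.mono fun a ha => sub_eq_zero.2 ha.2))⟩

/-- A function which satisfies the Koopman-van Hove equation on a dense set is a solution. -/
theorem solvesKvH_of_dense (hħ : ħ ≠ 0) (hJ : IsOpen J)
    (hH : ContMDiff (phaseModel n) 𝓘(ℝ, ℝ) 2 H)
    (hΨ : ContMDiffOn ((phaseModel n).prod 𝓘(ℝ, ℝ)) 𝓘(ℝ, ℂ) 2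
      (fun zt : PhaseSpace n Q × ℝ => Ψ zt.1 zt.2) (univ ×ˢ J))
    {D : Set (PhaseSpace n Q × ℝ)} (hD : Dense D)
    (h : ∀ zt ∈ D, zt.2 ∈ J →
      Complex.I * ħ * deriv (Ψ zt.1) zt.2 = covariantLiouvillian ħ H (fun w => Ψ w zt.2) zt.1) :
    SolvesKvH ħ H J Ψ := by
  intro t ht z
  refine ⟨differentiableAt_time_of_contMDiffOn hJ hΨ z ht,
    mdifferentiableAt_of_contMDiffOn hJ hΨ z ht, ?_⟩
  have hz : z ∈ (natChart z).source := mem_extChartAt_source z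
  rw [← flatKvHAt_readIn_iff hħ hJ hH hΨ hz ht]
  have hc := contDiffOn_readIn z hΨ
  refine flatKvHAt_of_frequently (isOpen_extTarget z hJ)
    (contDiffOn_readIn z (contMDiffOn_autonomous J hH)) (contDiffOn_re hc) (contDiffOn_im hc)
    (mem_extTarget hz ht) ?_
  have htend : Tendsto (fun zt : PhaseSpace n Q × ℝ => (natChart z zt.1, zt.2)) (𝓝 (z, t))
      (𝓝 (natChart z z, t)) := by
    rw [nhds_prod_eq, nhds_prod_eq]
    exact (continuousAt_extChartAt z).tendsto.prodMap tendsto_id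
  -- Points of the dense set accumulate at `(z, t)`, and the chart carries them to points
  -- accumulating at its image.
  refine htend.frequently ?_
  have hev : ∀ᶠ zt : PhaseSpace n Q × ℝ in 𝓝 (z, t), zt.1 ∈ (natChart z).source ∧ zt.2 ∈ J := by
    rw [nhds_prod_eq]
    exact Filter.Eventually.prod_mk (pa := fun w => w ∈ (natChart z).source)
      (extChartAt_source_mem_nhds z) (pb := fun s => s ∈ J) (hJ.mem_nhds ht)
  refine ((mem_closure_iff_frequently.1 (hD (z, t))).and_eventually hev).mono ?_
  rintro ⟨w, s⟩ ⟨h1, h2, h3⟩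
  exact (flatKvHAt_readIn_iff hħ hJ hH hΨ h2 h3).2 (h _ h1 h3)

/-- The density of a solution, in the natural chart at `z₀`. -/
abbrev readDensity (ħ : ℝ) (z₀ : PhaseSpace n Q) (Ψ : PhaseSpace n Q → ℝ → ℂ) : ExtModel n → ℝ :=
  flatDensity (extSharp n) (extEuler n) (1 + n) ħ
    (fun a => (readIn z₀ Ψ a).re) (fun a => (readIn z₀ Ψ a).im)

theorem readsAs_readDensity (hJ : IsOpen J)
    (hΨ : ContMDiffOn ((phaseModel n).prod 𝓘(ℝ, ℝ)) 𝓘(ℝ, ℂ) 2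
      (fun zt : PhaseSpace n Q × ℝ => Ψ zt.1 zt.2) (univ ×ˢ J))
    (z₀ : PhaseSpace n Q) {t : ℝ} (ht : t ∈ J) :
    ReadsAs z₀ t (fun z => density ħ (fun w => Ψ w t) z) (readDensity ħ z₀ Ψ) := by
  intro z h
  have hd := differentiableAt_readIn hJ hΨ h ht
  exact density_of_readsAs ħ h (mdifferentiableAt_of_contMDiffOn hJ hΨ z ht)
    (fun w hw => congrArg Complex.re (readsAs_readIn z₀ Ψ t w hw))
    (fun w hw => congrArg Complex.im (readsAs_readIn z₀ Ψ t w hw))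
    (Complex.reCLM.differentiableAt.comp _ hd) (Complex.imCLM.differentiableAt.comp _ hd)

/-- Joint differentiability in position and time is kept alongside the equation, because the chain
rule along an integral curve needs it. -/
theorem readDensity_liouville (hħ : ħ ≠ 0) (hJ : IsOpen J)
    (hH : ContMDiff (phaseModel n) 𝓘(ℝ, ℝ) 2 H)
    (hΨ : ContMDiffOn ((phaseModel n).prod 𝓘(ℝ, ℝ)) 𝓘(ℝ, ℂ) 2
      (fun zt : PhaseSpace n Q × ℝ => Ψ zt.1 zt.2) (univ ×ˢ J))
    (hK : SolvesKvH ħ H J Ψ) {z₀ z : PhaseSpace n Q} (h : z ∈ (natChart z₀).source) {t : ℝ}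
    (ht : t ∈ J) :
    DifferentiableAt ℝ (readDensity ħ z₀ Ψ) (natChart z₀ z, t) ∧
      fderiv ℝ (readDensity ħ z₀ Ψ) (natChart z₀ z, t) (timeDir n) =
        flatBracket (extSharp n) (readIn z₀ fun w _ => H w) (readDensity ħ z₀ Ψ)
          (natChart z₀ z, t) := by
  have hc := contDiffOn_readIn z₀ hΨ
  refine flatDensity_liouville apply_extSharp_antisymm apply_extEuler_extSharp extEuler_timeDir hħ
    (isOpen_extTarget z₀ hJ) (contDiffOn_readIn z₀ (contMDiffOn_autonomous J hH))
    (contDiffOn_re hc) (contDiffOn_im hc) ?_ (mem_extTarget h ht)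
  rintro ⟨e, s⟩ ⟨he, hs⟩
  have h1 := flatKvHAt_readIn_iff hħ hJ hH hΨ ((natChart z₀).map_target he) hs
  rw [(natChart z₀).right_inv he] at h1
  exact h1.2 (hK s hs _).2.2

/-- The density of a solution of the Koopman-van Hove equation solves the Liouville equation. -/
theorem solvesLiouville_density (hħ : ħ ≠ 0) (hJ : IsOpen J)
    (hH : ContMDiff (phaseModel n) 𝓘(ℝ, ℝ) 2 H)
    (hΨ : ContMDiffOn ((phaseModel n).prod 𝓘(ℝ, ℝ)) 𝓘(ℝ, ℂ) 2
      (fun zt : PhaseSpace n Q × ℝ => Ψ zt.1 zt.2) (univ ×ˢ J))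
    (hK : SolvesKvH ħ H J Ψ) :
    SolvesLiouville H J (fun z t => density ħ (fun w => Ψ w t) z) := by
  intro t ht z
  have hz : z ∈ (natChart z).source := mem_extChartAt_source z
  obtain ⟨h1, h2⟩ := readDensity_liouville hħ hJ hH hΨ hK hz ht
  have h3 := readsAs_readDensity (ħ := ħ) hJ hΨ z ht
  refine ⟨(hasMFDerivAt_of_readsAs hz h3 h1).mdifferentiableAt, ?_⟩
  rw [poisson_of_readsAs hz (readsAs_readIn z (fun w _ => H w) t)
    (differentiableAt_readIn hJ (contMDiffOn_autonomous J hH) hz ht) h3 h1, ← h2]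
  refine (hasDerivAt_of_extModel h1).congr_of_eventuallyEq ?_
  filter_upwards [hJ.mem_nhds ht] with s hs using readsAs_readDensity hJ hΨ z hs z hz

/-- The density of a solution is constant along the integral curves of the Hamiltonian field. -/
theorem hasDerivWithinAt_density_comp_integralCurve (hħ : ħ ≠ 0) (hJ : IsOpen J)
    (hH : ContMDiff (phaseModel n) 𝓘(ℝ, ℝ) 2 H)
    (hΨ : ContMDiffOn ((phaseModel n).prod 𝓘(ℝ, ℝ)) 𝓘(ℝ, ℂ) 2
      (fun zt : PhaseSpace n Q × ℝ => Ψ zt.1 zt.2) (univ ×ˢ J))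
    (hK : SolvesKvH ħ H J Ψ) {γ : ℝ → PhaseSpace n Q} {I : Set ℝ} (hI : I ⊆ J)
    (hγ : IsMIntegralCurveOn γ (hamiltonianField H) I) {r : ℝ} (hr : r ∈ I) :
    HasDerivWithinAt (fun r => density ħ (fun w => Ψ w r) (γ r)) 0 I r := by
  set z₀ := γ r with hz₀
  have hz : z₀ ∈ (natChart z₀).source := mem_extChartAt_source z₀
  obtain ⟨h1, h2⟩ := readDensity_liouville hħ hJ hH hΨ hK hz (hI hr)
  have hγr := hγ r hr
  have hch : HasMFDerivWithinAt 𝓘(ℝ, ℝ) 𝓘(ℝ, Model n × (Model n →L[ℝ] ℝ))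
      (natChart z₀ ∘ γ) I r _ :=
    ((mdifferentiableAt_extChartAt (mem_chart_source _ z₀)).hasMFDerivAt.comp_hasMFDerivWithinAt
      r hγr)
  have hcurve : HasDerivWithinAt (fun s => natChart z₀ (γ s))
      (hamiltonianField H z₀ : Model n × (Model n →L[ℝ] ℝ)) I r := by
    have h3 : HasFDerivWithinAt (fun s => natChart z₀ (γ s)) ((chartDeriv z₀ z₀).comp
        (ContinuousLinearMap.smulRight (1 : ℝ →L[ℝ] ℝ)
          (hamiltonianField H z₀ : Model n × (Model n →L[ℝ] ℝ)))) I r :=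
      hasMFDerivWithinAt_iff_hasFDerivWithinAt.1 hch
    rw [chartDeriv_self, ContinuousLinearMap.id_comp] at h3
    exact h3.hasDerivWithinAt.congr_deriv
      (one_smul ℝ (hamiltonianField H z₀ : Model n × (Model n →L[ℝ] ℝ)))
  have hfull := HasFDerivAt.comp_hasDerivWithinAt (f := fun s => (natChart z₀ (γ s), s)) r
    h1.hasFDerivAt (hcurve.prodMk (hasDerivWithinAt_id r I))
  -- The extended velocity `(X_H, 1)` is `S dH` plus the time direction. The density changes by -{H,
  -- D} along the first and by ∂D/∂t along the second, and the Liouville equation makes these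
  -- opposite.
  have hzero : fderiv ℝ (readDensity ħ z₀ Ψ) (natChart z₀ z₀, r)
      ((hamiltonianField H z₀ : Model n × (Model n →L[ℝ] ℝ)), 1) = 0 := by
    have h3 := dirDeriv_of_readsAs hz (readsAs_readIn z₀ (fun w _ => H w) r)
      (differentiableAt_readIn hJ (contMDiffOn_autonomous J hH) hz (hI hr))
    rw [chartDeriv_self] at h3
    have h4 : (((hamiltonianField H z₀ : Model n × (Model n →L[ℝ] ℝ)), 1) : ExtModel n) =
        extSharp n (fderiv ℝ (readIn z₀ fun w _ => H w) (natChart z₀ z₀, r)) + timeDir n := by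
      rw [extSharp_apply, sharp_apply, timeDir, hamiltonianField]
      simp only [partialP, partialQ, h3]
      simp
    rw [h4, map_add, h2, flatBracket, apply_extSharp_antisymm]
    exact neg_add_cancel _
  rw [hzero] at hfull
  refine HasDerivWithinAt.congr_of_eventuallyEq hfull ?_ ?_
  · have hev := hγr.1 (extChartAt_source_mem_nhds (I := phaseModel n) z₀)
    filter_upwards [hev, self_mem_nhdsWithin] with s hs hs'
    exact readsAs_readDensity hJ hΨ z₀ (hI hs') (γ s) hs
  · exact readsAs_readDensity hJ hΨ z₀ (hI hr) z₀ hz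

theorem density_comp_integralCurve (hħ : ħ ≠ 0) (hJ : IsOpen J) (hJc : J.OrdConnected)
    (hH : ContMDiff (phaseModel n) 𝓘(ℝ, ℝ) 2 H)
    (hΨ : ContMDiffOn ((phaseModel n).prod 𝓘(ℝ, ℝ)) 𝓘(ℝ, ℂ) 2
      (fun zt : PhaseSpace n Q × ℝ => Ψ zt.1 zt.2) (univ ×ˢ J))
    (hK : SolvesKvH ħ H J Ψ) {s t : ℝ} (hs : s ∈ J) (ht : t ∈ J) {γ : ℝ → PhaseSpace n Q}
    (hγ : IsMIntegralCurveOn γ (hamiltonianField H) (uIcc s t)) :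
    density ħ (fun w => Ψ w t) (γ t) = density ħ (fun w => Ψ w s) (γ s) := by
  have h1 : ∀ r ∈ uIcc s t, HasDerivWithinAt (fun r => density ħ (fun w => Ψ w r) (γ r)) 0
      (uIcc s t) r := fun r hr =>
    hasDerivWithinAt_density_comp_integralCurve hħ hJ hH hΨ hK (hJc.uIcc_subset hs ht) hγ hr
  -- The mean value inequality with bound zero; one-sided derivatives at the end points suffice.
  have h2 := (convex_uIcc s t).norm_image_sub_le_of_norm_hasDerivWithin_le (C := 0) h1 (by simp)
    left_mem_uIcc right_mem_uIcc
  simpa [sub_eq_zero] using h2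

/-- If the Hamiltonian field is complete, then every value of the density at the time `t` is a value
of the density at the time `s`. -/
theorem exists_density_eq_of_complete (hħ : ħ ≠ 0) (hJ : IsOpen J) (hJc : J.OrdConnected)
    (hH : ContMDiff (phaseModel n) 𝓘(ℝ, ℝ) 2 H)
    (hΨ : ContMDiffOn ((phaseModel n).prod 𝓘(ℝ, ℝ)) 𝓘(ℝ, ℂ) 2
      (fun zt : PhaseSpace n Q × ℝ => Ψ zt.1 zt.2) (univ ×ˢ J))
    (hK : SolvesKvH ħ H J Ψ) (hc : IsCompleteHamiltonian H) {s t : ℝ} (hs : s ∈ J) (ht : t ∈ J)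
    (z : PhaseSpace n Q) :
    ∃ w, density ħ (fun w => Ψ w t) z = density ħ (fun w => Ψ w s) w := by
  obtain ⟨γ, hγ0, hγ⟩ := hc z
  -- The curve through `z` at time `0` is shifted to pass through `z` at time `t`; its position at
  -- time `s` is the witness.
  have h1 := density_comp_integralCurve hħ hJ hJc hH hΨ hK hs ht
    ((hγ.comp_add (-t)).isMIntegralCurveOn _)
  refine ⟨_, Eq.trans ?_ h1⟩
  simp [hγ0]

end Solutions

/-! ### Projection onto the joint eigenstates -/

section Projection

variable {𝓗 : Type*} [NormedAddCommGroup 𝓗] [InnerProductSpace ℂ 𝓗] {N : ℕ}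
  {α : Fin N → 𝓗 →ₗ.[ℂ] 𝓗} {X : Type*} [MeasurableSpace X] {ν : Measure X}

namespace JointEigenstates

variable (B : JointEigenstates α ν)

/-- The function `x ↦ ⟨x|ψ⟩`. -/
def bra (ψ : 𝓗) : X → ℂ := B.proj ψ

theorem bra_smul (c : ℂ) (ψ : 𝓗) : B.bra (c • ψ) =ᵐ[ν] fun x => c * B.bra ψ x := by
  unfold bra
  rw [map_smul]
  exact Lp.coeFn_smul c (B.proj ψ)

theorem bra_add (ψ φ : 𝓗) : B.bra (ψ + φ) =ᵐ[ν] fun x => B.bra ψ x + B.bra φ x := by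
  unfold bra
  rw [map_add]
  exact Lp.coeFn_add _ _

theorem bra_sub (ψ φ : 𝓗) : B.bra (ψ - φ) =ᵐ[ν] fun x => B.bra ψ x - B.bra φ x := by
  unfold bra
  rw [map_sub]
  exact Lp.coeFn_sub _ _

theorem bra_zero : B.bra 0 =ᵐ[ν] fun _ => 0 := by
  unfold bra
  rw [map_zero]
  exact Lp.coeFn_zero _ _ _

theorem bra_sum {ι : Type*} (s : Finset ι) (ψ : ι → 𝓗) :
    B.bra (∑ i ∈ s, ψ i) =ᵐ[ν] fun x => ∑ i ∈ s, B.bra (ψ i) x := by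
  classical
  induction s using Finset.induction_on with
  | empty => simpa using B.bra_zero
  | insert i s hi ih =>
    rw [Finset.sum_insert hi]
    filter_upwards [B.bra_add (ψ i) (∑ i ∈ s, ψ i), ih] with x h1 h2
    rw [h1, h2, Finset.sum_insert hi]

/-- A limit in `𝓗` has a subsequence whose projections converge almost everywhere. -/
theorem exists_seq_tendsto_bra {ι : Type*} {l : Filter ι} [l.NeBot] [l.IsCountablyGenerated]
    {f : ι → 𝓗} {ψ : 𝓗} (hf : Tendsto f l (𝓝 ψ)) :
    ∃ ns : ℕ → ι, Tendsto ns atTop l ∧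
      ∀ᵐ x ∂ν, Tendsto (fun k => B.bra (f (ns k)) x) atTop (𝓝 (B.bra ψ x)) := by
  obtain ⟨ms, hms⟩ := l.exists_seq_tendsto
  have h1 : Tendsto (fun k => B.proj (f (ms k))) atTop (𝓝 (B.proj ψ)) :=
    (B.proj.continuous.tendsto ψ).comp (hf.comp hms)
  obtain ⟨ks, hks, h2⟩ := (tendstoInMeasure_of_tendsto_Lp h1).exists_seq_tendsto_ae
  exact ⟨ms ∘ ks, hms.comp hks.tendsto_atTop, h2⟩

/-- A limit in `𝓗` and a limit almost everywhere of the projections agree. -/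
theorem ae_eq_bra_of_tendsto {ι : Type*} {l : Filter ι} [l.NeBot] [l.IsCountablyGenerated]
    {f : ι → 𝓗} {ψ : 𝓗} (hf : Tendsto f l (𝓝 ψ)) {g : ι → X → ℂ} {g' : X → ℂ}
    (hfg : ∀ᶠ i in l, g i =ᵐ[ν] B.bra (f i)) (hg : ∀ᵐ x ∂ν, Tendsto (fun i => g i x) l (𝓝 (g' x))) :
    g' =ᵐ[ν] B.bra ψ := by
  obtain ⟨ns, hns, h1⟩ := B.exists_seq_tendsto_bra hf
  obtain ⟨k₀, hk₀⟩ := eventually_atTop.1 (hns.eventually hfg)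
  have h2 : ∀ᵐ x ∂ν, ∀ k, k₀ ≤ k → g (ns k) x = B.bra (f (ns k)) x :=
    ae_all_iff.2 fun k => ae_all_iff.2 fun hk => hk₀ k hk
  filter_upwards [h1, h2, hg] with x hx1 hx2 hx3
  refine tendsto_nhds_unique (hx3.comp hns) (hx1.congr' ?_)
  filter_upwards [eventually_ge_atTop k₀] with k hk using (hx2 k hk).symm

/-- The operators with graph `T` act as the multiplication by `c` on the projections. -/
def ActsAs (T : OpGraph 𝓗) (c : X → ℝ) : Prop :=
  ∀ p ∈ T, B.bra p.2 =ᵐ[ν] fun x => (c x : ℂ) * B.bra p.1 x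

/-- Multiplication by a fixed function is closed: along a subsequence the arguments converge almost
everywhere, hence so do the products, and their limit must agree with the limit in L². -/
theorem ActsAs.closure {T : OpGraph 𝓗} {c : X → ℝ} (h : B.ActsAs T c) :
    B.ActsAs (closure T) c := by
  intro p hp
  obtain ⟨s, hs, hlim⟩ := mem_closure_iff_seq_limit.1 hp
  have h1 : Tendsto (fun k => (s k).1) atTop (𝓝 p.1) := (continuous_fst.tendsto p).comp hlim
  have h2 : Tendsto (fun k => (s k).2) atTop (𝓝 p.2) := (continuous_snd.tendsto p).comp hlim
  obtain ⟨ns, hns, h3⟩ := B.exists_seq_tendsto_bra h1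
  refine (B.ae_eq_bra_of_tendsto (h2.comp hns)
    (g := fun k x => (c x : ℂ) * B.bra (s (ns k)).1 x) (.of_forall fun k => ?_) ?_).symm
  · exact (h _ (hs (ns k))).symm
  · filter_upwards [h3] with x hx using hx.const_mul _

theorem bra_wordApply {w : List (Fin N)} {ψ φ : 𝓗} (h : WordApply α w ψ φ) :
    B.bra φ =ᵐ[ν] fun x => ((w.map (B.eigenvalue x)).prod : ℝ) * B.bra ψ x := by
  induction w generalizing φ with
  | nil =>
    obtain rfl : φ = ψ := h
    exact .of_forall fun x => by simp
  | cons i w ih =>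
    obtain ⟨χ, h1, h2⟩ := h
    filter_upwards [ih h1, (B.diagonal i χ φ).1 h2] with x hx1 hx2
    simp only [bra] at hx1 ⊢
    rw [hx2, hx1, List.map_cons, List.prod_cons, Complex.ofReal_mul, mul_assoc]

/-- The order of the factors is irrelevant after projection, because the eigenvalues are commuting
numbers and only their multiplicities count. -/
theorem bra_monomialApply {m : Fin N → ℕ} {ψ φ : 𝓗} (h : MonomialApply α m ψ φ) :
    B.bra φ =ᵐ[ν] fun x => ((∏ i, B.eigenvalue x i ^ m i : ℝ) : ℂ) * B.bra ψ x := by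
  obtain ⟨w, hw, h⟩ := h
  filter_upwards [B.bra_wordApply h] with x hx
  rw [hx, Finset.prod_list_map_count, ← Finset.prod_subset (Finset.subset_univ w.toFinset)]
  · simp_rw [hw]
  · intro i _ hi
    rw [← hw i, List.count_eq_zero_of_not_mem (by simpa using hi), pow_zero]

/-- An analytic function of the observables acts as the multiplication by the function of the joint
eigenvalues. -/
theorem actsAs_analyticFunction {c : (Fin N → ℕ) → ℝ} {f : (Fin N → ℝ) → ℝ}
    (hf : ∀ᵐ x ∂ν, HasSum (fun m => c m * ∏ i, B.eigenvalue x i ^ m i) (f (B.eigenvalue x))) :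
    B.ActsAs (analyticFunction α c) (fun x => f (B.eigenvalue x)) := by
  refine ActsAs.closure B ?_
  rintro ⟨ψ, φ⟩ ⟨χ, hχ, hsum⟩
  have h1 : ∀ m, B.bra ((c m : ℂ) • χ m) =ᵐ[ν] fun x =>
      ((c m * ∏ i, B.eigenvalue x i ^ m i : ℝ) : ℂ) * B.bra ψ x := by
    intro m
    -- For a vanishing coefficient `χ m` is an arbitrary vector, but the term is zero on both sides.
    by_cases hc : c m = 0
    · simpa [hc] using B.bra_zero
    · filter_upwards [B.bra_smul (c m) (χ m), B.bra_monomialApply (hχ m hc)] with x hx1 hx2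
      rw [hx1, hx2]
      push_cast
      ring
  -- The limit runs over finite sets of multi-indices. There are countably many multi-indices, so
  -- this filter is countably generated and subsequences are available.
  refine (B.ae_eq_bra_of_tendsto (f := fun s => ∑ m ∈ s, (c m : ℂ) • χ m) (l := atTop) hsum
    (g := fun s x => ∑ m ∈ s, ((c m * ∏ i, B.eigenvalue x i ^ m i : ℝ) : ℂ) * B.bra ψ x)
    (.of_forall fun s => ?_) ?_).symm
  · filter_upwards [B.bra_sum s (fun m => (c m : ℂ) • χ m), ae_all_iff.2 h1] with x hx1 hx2
    rw [hx1]
    exact Finset.sum_congr rfl fun m _ => (hx2 m).symm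
  · filter_upwards [hf] with x hx
    exact (Complex.hasSum_ofReal.2 hx).mul_right (B.bra ψ x)

/-- Almost every joint eigenvalue belongs to the joint spectrum. -/
theorem ae_eigenvalue_mem_jointSpectrum [SigmaFinite ν] :
    ∀ᵐ x ∂ν, B.eigenvalue x ∈ jointSpectrum α := by
  have key : (ν.map B.eigenvalue) (jointSpectrum α)ᶜ = 0 := by
    -- It suffices to find a null neighbourhood of each point `a` outside the joint spectrum. If the
    -- preimage of the ball of radius `ε / 2` had positive measure, a normalised indicator supported
    -- there would be an approximate joint eigenvector with error below `ε`.
    refine measure_null_of_locally_null _ fun a ha => ?_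
    simp only [jointSpectrum, mem_compl_iff, mem_ofPred_eq] at ha
    push Not at ha
    obtain ⟨ε, hε, ha⟩ := ha
    refine ⟨Metric.ball a (ε / 2),
      mem_nhdsWithin_of_mem_nhds (Metric.ball_mem_nhds a (by positivity)), ?_⟩
    rw [Measure.map_apply B.measurable_eigenvalue Metric.isOpen_ball.measurableSet]
    set S := B.eigenvalue ⁻¹' Metric.ball a (ε / 2) with hS
    have hSm : MeasurableSet S := B.measurable_eigenvalue Metric.isOpen_ball.measurableSet
    by_contra hne
    -- σ-finiteness provides a part of finite positive measure, whose indicator is a nonzero element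
    -- of L².
    obtain ⟨S', hS'S, hS'm, hpos, hfin⟩ :
        ∃ S', S' ⊆ S ∧ MeasurableSet S' ∧ 0 < ν S' ∧ ν S' < ⊤ := by
      obtain ⟨S', h1, h2, h3, h4⟩ := Measure.exists_subset_measure_lt_top hSm
        (pos_iff_ne_zero.2 hne)
      exact ⟨S', h2, h1, h3, h4⟩
    set f₀ : Lp ℂ 2 ν := indicatorConstLp 2 hS'm hfin.ne (1 : ℂ) with hf₀
    have hf₀n : ‖f₀‖ ≠ 0 := by
      rw [hf₀, norm_indicatorConstLp (by norm_num) (by norm_num)]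
      have : 0 < ν.real S' := ENNReal.toReal_pos hpos.ne' hfin.ne
      simpa using this.ne'
    set f : Lp ℂ 2 ν := ((‖f₀‖⁻¹ : ℝ) : ℂ) • f₀ with hf
    have hfn : ‖f‖ = 1 := by
      rw [hf, norm_smul, Complex.norm_real, norm_inv, norm_norm, inv_mul_cancel₀ hf₀n]
    have hfS : ∀ᵐ x ∂ν, x ∉ S → (f : X → ℂ) x = 0 := by
      filter_upwards [Lp.coeFn_smul ((‖f₀‖⁻¹ : ℝ) : ℂ) f₀,
        indicatorConstLp_coeFn (p := 2) (hs := hS'm) (hμs := hfin.ne) (c := (1 : ℂ))] with x h1 h2 hx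
      rw [h1, Pi.smul_apply, h2, indicator_of_notMem fun h => hx (hS'S h), smul_zero]
    obtain ⟨i, hi⟩ := ha (B.proj.symm f) (by simpa using hfn)
    have hle : ∀ᵐ x ∂ν, ‖((B.eigenvalue x i : ℂ) - (a i : ℂ)) * (f : X → ℂ) x‖ ≤
        ε / 2 * ‖(f : X → ℂ) x‖ := by
      filter_upwards [hfS] with x hx
      by_cases hxS : x ∈ S
      · rw [norm_mul, ← Complex.ofReal_sub, Complex.norm_real]
        gcongr
        exact ((dist_eq_norm (B.eigenvalue x i) (a i)).symm.le.trans
          (dist_le_pi_dist _ _ i)).trans (Metric.mem_ball.1 hxS).le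
      · simp [hx hxS]
    have hmeas : AEStronglyMeasurable
        (fun x => ((B.eigenvalue x i : ℂ) - (a i : ℂ)) * (f : X → ℂ) x) ν :=
      ((Complex.measurable_ofReal.comp
        ((measurable_pi_apply i).comp B.measurable_eigenvalue)).sub_const
          _).aestronglyMeasurable.mul (Lp.aestronglyMeasurable f)
    have hmem := (Lp.memLp f).of_le_mul hmeas hle
    have hg := hmem.coeFn_toLp
    set g := hmem.toLp _
    -- Since `g` is `(αᵢ(x) - aᵢ) f`, the vector `g + aᵢ f` represents the observable applied to
    -- `f`, and its distance from `aᵢ f` is `‖g‖`.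
    have h1 := hi (B.proj.symm (g + (a i : ℂ) • f)) ((B.diagonal i _ _).2 (by
      simp only [LinearIsometryEquiv.apply_symm_apply]
      filter_upwards [hg, Lp.coeFn_add g ((a i : ℂ) • f), Lp.coeFn_smul (a i : ℂ) f]
        with x h1 h2 h3
      rw [h2, Pi.add_apply, h1, h3, Pi.smul_apply, smul_eq_mul]
      ring))
    have h2 : ‖g‖ ≤ ε / 2 * ‖f‖ := Lp.norm_le_mul_norm_of_ae_le_mul (by
      filter_upwards [hg, hle] with x h1 h2
      rwa [h1])
    rw [map_add, map_smul, add_sub_cancel_right, LinearIsometryEquiv.norm_map] at h1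
    rw [hfn] at h2
    linarith
  exact ae_of_ae_map B.measurable_eigenvalue.aemeasurable key

end JointEigenstates

end Projection

/-! ### Projection of phase-space, time and operator derivatives. -/

section Derivatives

variable {n : ℕ} {Q : Type*} [TopologicalSpace Q] [ChartedSpace (Model n) Q]
  [IsManifold (𝓡 n) ∞ Q] {𝓗 : Type*} [NormedAddCommGroup 𝓗] [InnerProductSpace ℂ 𝓗] {N : ℕ}
  {α : Fin N → 𝓗 →ₗ.[ℂ] 𝓗} {X : Type*} [MeasurableSpace X] {ν : Measure X}

/-- A sequence which converges to `z` in the direction `v`. -/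
def approach (v : Model n × (Model n →L[ℝ] ℝ)) (z : PhaseSpace n Q) (k : ℕ) : PhaseSpace n Q :=
  (natChart z).symm (natChart z z + (k : ℝ)⁻¹ • v)

theorem tendsto_approach (v : Model n × (Model n →L[ℝ] ℝ)) (z : PhaseSpace n Q) :
    Tendsto (approach v z) atTop (𝓝 z) := by
  have h1 : Tendsto (fun k : ℕ => natChart z z + (k : ℝ)⁻¹ • v) atTop (𝓝 (natChart z z)) := by
    simpa using tendsto_const_nhds.add
      ((tendsto_inv_atTop_nhds_zero_nat (𝕜 := ℝ)).smul_const v)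
  have h2 := (continuousAt_extChartAt_symm z).tendsto.comp h1
  rwa [extChartAt_to_inv] at h2

/-- Writes the derivative as a limit over a sequence, so that only countably many null sets arise
when the difference quotients are projected. -/
theorem tendsto_dirDeriv {V : Type*} [NormedAddCommGroup V] [NormedSpace ℝ V]
    (v : Model n × (Model n →L[ℝ] ℝ)) {F : PhaseSpace n Q → V} {z : PhaseSpace n Q}
    (hF : MDifferentiableAt (phaseModel n) 𝓘(ℝ, V) F z) :
    Tendsto (fun k : ℕ => (k : ℝ) • (F (approach v z k) - F z)) atTop (𝓝 (dirDeriv v F z)) := by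
  obtain ⟨l, hl⟩ : ∃ l : Model n × (Model n →L[ℝ] ℝ) →L[ℝ] V,
      l = mfderiv (phaseModel n) 𝓘(ℝ, V) F z := ⟨_, rfl⟩
  have h1 : HasFDerivWithinAt (F ∘ (natChart z).symm) l (range (phaseModel n)) (natChart z z) :=
    hl ▸ hF.hasMFDerivAt.2
  rw [ModelWithCorners.range_eq_univ, hasFDerivWithinAt_univ] at h1
  have h2 := h1.lim v (c := fun k : ℕ => (k : ℝ)) (l := atTop)
    (by simpa using tendsto_natCast_atTop_atTop)
  have h3 : dirDeriv v F z = l v := by rw [hl]; rfl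
  have h4 : F z = (F ∘ (natChart z).symm) (natChart z z) := by
    rw [Function.comp_apply, extChartAt_to_inv]
  rw [h3, h4]
  exact h2

theorem tendsto_deriv_nat {V : Type*} [NormedAddCommGroup V] [NormedSpace ℝ V]
    {F : ℝ → V} {t : ℝ} (hF : DifferentiableAt ℝ F t) :
    Tendsto (fun k : ℕ => (k : ℝ) • (F (t + (k : ℝ)⁻¹) - F t)) atTop (𝓝 (deriv F t)) := by
  have h3 := hF.hasDerivAt.hasFDerivAt.lim 1 (c := fun k : ℕ => (k : ℝ)) (l := atTop)
    (by simpa using tendsto_natCast_atTop_atTop)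
  simpa using h3

namespace JointEigenstates

variable (B : JointEigenstates α ν)

theorem bra_real_smul_sub (r : ℝ) (ψ φ : 𝓗) :
    B.bra (r • (ψ - φ)) =ᵐ[ν] fun x => r • (B.bra ψ x - B.bra φ x) := by
  filter_upwards [B.bra_smul (r : ℂ) (ψ - φ), B.bra_sub ψ φ] with x h1 h2
  rw [← Complex.coe_smul r (ψ - φ), h1, h2, Complex.real_smul]

/-- The projection commutes with the derivatives on phase space. -/
theorem dirDeriv_ae_eq_bra (v : Model n × (Model n →L[ℝ] ℝ)) {F : PhaseSpace n Q → 𝓗}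
    {z : PhaseSpace n Q} (hF : MDifferentiableAt (phaseModel n) 𝓘(ℝ, 𝓗) F z)
    {y : X → PhaseSpace n Q → ℂ} (hy : ∀ᶠ w in 𝓝 z, (fun x => y x w) =ᵐ[ν] B.bra (F w))
    (hyd : ∀ᵐ x ∂ν, MDifferentiableAt (phaseModel n) 𝓘(ℝ, ℂ) (y x) z) :
    (fun x => dirDeriv v (y x) z) =ᵐ[ν] B.bra (dirDeriv v F z) := by
  refine B.ae_eq_bra_of_tendsto (tendsto_dirDeriv v hF)
    (g := fun k x => (k : ℝ) • (y x (approach v z k) - y x z)) ?_ ?_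
  · filter_upwards [(tendsto_approach v z).eventually hy] with k hk
    filter_upwards [hk, hy.self_of_nhds, B.bra_real_smul_sub k (F (approach v z k)) (F z)]
      with x h1 h2 h3
    rw [h1, h2, h3]
  · filter_upwards [hyd] with x hx using tendsto_dirDeriv v hx

/-- The projection commutes with the time derivative. -/
theorem deriv_ae_eq_bra {F : ℝ → 𝓗} {t : ℝ} (hF : DifferentiableAt ℝ F t)
    {y : X → ℝ → ℂ} (hy : ∀ᶠ s in 𝓝 t, (fun x => y x s) =ᵐ[ν] B.bra (F s))
    (hyd : ∀ᵐ x ∂ν, DifferentiableAt ℝ (y x) t) :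
    (fun x => deriv (y x) t) =ᵐ[ν] B.bra (deriv F t) := by
  have htend : Tendsto (fun k : ℕ => t + (k : ℝ)⁻¹) atTop (𝓝 t) := by
    simpa using tendsto_const_nhds.add (tendsto_inv_atTop_nhds_zero_nat (𝕜 := ℝ))
  refine B.ae_eq_bra_of_tendsto (tendsto_deriv_nat hF)
    (g := fun k x => (k : ℝ) • (y x (t + (k : ℝ)⁻¹) - y x t)) ?_ ?_
  · filter_upwards [htend.eventually hy] with k hk
    filter_upwards [hk, hy.self_of_nhds, B.bra_real_smul_sub k (F (t + (k : ℝ)⁻¹)) (F t)]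
      with x h1 h2 h3
    rw [h1, h2, h3]
  · filter_upwards [hyd] with x hx using tendsto_deriv_nat hx

/-- The derivative of an operator which acts as a multiplication acts as the multiplication by the
derivative. -/
theorem actsAs_opDeriv (v : Model n × (Model n →L[ℝ] ℝ)) {T : PhaseSpace n Q → OpGraph 𝓗}
    {c : PhaseSpace n Q → X → ℝ} (hT : ∀ z, B.ActsAs (T z) (c z)) {z : PhaseSpace n Q}
    (hc : ∀ᵐ x ∂ν, MDifferentiableAt (phaseModel n) 𝓘(ℝ, ℝ) (fun w => c w x) z) :
    B.ActsAs (opDeriv v T z) (fun x => dirDeriv v (fun w => c w x) z) := by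
  refine ActsAs.closure B ?_
  rintro ⟨ψ, φ⟩ ⟨F, hF, hFd, hφ⟩
  -- Multiplication of a real number by the fixed value ⟨x|ψ⟩ is packaged as a continuous linear
  -- map, so that it commutes with differentiation.
  have hlin : ∀ x, ∃ l : ℝ →L[ℝ] ℂ, ∀ r : ℝ, l r = (r : ℂ) * B.bra ψ x := fun x =>
    ⟨Complex.ofRealCLM.smulRight (B.bra ψ x), fun r => rfl⟩
  choose l hl using hlin
  have h1 := B.dirDeriv_ae_eq_bra v hFd (y := fun x w => l x (c w x))
    (by filter_upwards [hF] with w hw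
        filter_upwards [hT w _ hw] with x hx
        rw [hl, hx])
    (by filter_upwards [hc] with x hx
        exact ((l x).hasFDerivAt.hasMFDerivAt.comp z hx.hasMFDerivAt).mdifferentiableAt)
  change dirDeriv v F z = φ at hφ
  rw [hφ] at h1
  filter_upwards [h1, hc] with x hx hcx
  rw [← hx, dirDeriv_clm_comp (l x) hcx v, hl]

end JointEigenstates

end Derivatives

/-! ### The projected equation -/

section Hybrid

variable {n : ℕ} {Q : Type*} [TopologicalSpace Q] [ChartedSpace (Model n) Q]
  [IsManifold (𝓡 n) ∞ Q]

/-- A natural chart covers all fibres over its base chart, so the charts at the zero covectors over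
countably many points of `Q` already cover T*Q. -/
theorem secondCountable_phaseSpace [SecondCountableTopology Q] :
    SecondCountableTopology (PhaseSpace n Q) := by
  obtain ⟨s, hs, hsU⟩ := TopologicalSpace.countable_cover_nhds
    (fun q : Q => extChartAt_source_mem_nhds (I := 𝓡 n) q)
  have hcover : ⋃ z ∈ (fun q : Q => (⟨q, (0 : Model n →L[ℝ] ℝ)⟩ : PhaseSpace n Q)) '' s,
      (chartAt (ModelProd (Model n) (Model n →L[ℝ] ℝ)) z).source = univ := by
    refine eq_univ_of_forall fun w => ?_
    have hw : w.proj ∈ ⋃ q ∈ s, (extChartAt (𝓡 n) q).source := hsU ▸ mem_univ _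
    obtain ⟨q, hq, hwq⟩ := mem_iUnion₂.1 hw
    refine mem_iUnion₂.2 ⟨_, mem_image_of_mem _ hq, ?_⟩
    rw [← extChartAt_source (phaseModel n), ← natChart, natChart_source]
    exact hwq
  have : SecondCountableTopology (ModelProd (Model n) (Model n →L[ℝ] ℝ)) :=
    inferInstanceAs (SecondCountableTopology (Model n × (Model n →L[ℝ] ℝ)))
  exact ChartedSpace.secondCountable_of_countable_cover _ hcover (hs.image _)

variable {𝓗 : Type*} [NormedAddCommGroup 𝓗] [InnerProductSpace ℂ 𝓗] {N : ℕ}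
  {α : Fin N → 𝓗 →ₗ.[ℂ] 𝓗} {X : Type*} [MeasurableSpace X] {ν : Measure X}

/-- The projection of the hybrid Liouvillian is the covariant Liouvillian. -/
theorem JointEigenstates.bra_hybridLiouvillian (B : JointEigenstates α ν) {ħ : ℝ}
    {T : PhaseSpace n Q → OpGraph 𝓗} {c : PhaseSpace n Q → X → ℝ}
    (hT : ∀ z, B.ActsAs (T z) (c z)) {z : PhaseSpace n Q}
    (hc : ∀ᵐ x ∂ν, MDifferentiableAt (phaseModel n) 𝓘(ℝ, ℝ) (fun w => c w x) z)
    {Υ : PhaseSpace n Q → 𝓗} (hΥ : MDifferentiableAt (phaseModel n) 𝓘(ℝ, 𝓗) Υ z)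
    {y : X → PhaseSpace n Q → ℂ} (hy : ∀ w, (fun x => y x w) =ᵐ[ν] B.bra (Υ w))
    (hyd : ∀ᵐ x ∂ν, MDifferentiableAt (phaseModel n) 𝓘(ℝ, ℂ) (y x) z)
    {χ : 𝓗} (hχ : HybridLiouvillian ħ T Υ z χ) :
    B.bra χ =ᵐ[ν] fun x => covariantLiouvillian ħ (fun w => c w x) (y x) z := by
  obtain ⟨a, b, d, e, ha, hb, hd, he, rfl⟩ := hχ
  have ha' := ae_all_iff.2 fun i => B.actsAs_opDeriv (dirQ i) hT hc _ (ha i)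
  have hb' := ae_all_iff.2 fun i => B.actsAs_opDeriv (dirP i) hT hc _ (hb i)
  have hd' := ae_all_iff.2 fun i => B.actsAs_opDeriv (dirP i) hT hc _ (hd i)
  have hyP := ae_all_iff.2 fun i => B.dirDeriv_ae_eq_bra (dirP i) hΥ (.of_forall hy) hyd
  have hyQ := ae_all_iff.2 fun i => B.dirDeriv_ae_eq_bra (dirQ i) hΥ (.of_forall hy) hyd
  have hds := ae_all_iff.2 fun i => B.bra_smul (momentum z i z : ℂ) (d i)
  have hab := ae_all_iff.2 fun i => B.bra_sub (a i) (b i)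
  filter_upwards [ha', hb', hd', hyP, hyQ, hds, hab, hT z _ he, hy z, hc,
    B.bra_add ((Complex.I * ħ) • ∑ i, (a i - b i)) (e - ∑ i, (momentum z i z : ℂ) • d i),
    B.bra_smul (Complex.I * ħ) (∑ i, (a i - b i)), B.bra_sub e (∑ i, (momentum z i z : ℂ) • d i),
    B.bra_sum Finset.univ (fun i => a i - b i),
    B.bra_sum Finset.univ (fun i => (momentum z i z : ℂ) • d i)]
    with x h1 h2 h3 h4 h5 h6 h7 h8 h9 h10 h11 h12 h13 h14 h15
  have hof : ∀ v, dirDeriv v (fun w => (c w x : ℂ)) z = (dirDeriv v (fun w => c w x) z : ℝ) :=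
    dirDeriv_clm_comp Complex.ofRealCLM h10
  simp only [h11, h12, h13, h14, h15, h6, h7, h1, h2, h3, h8, ← h4, ← h5, ← h9]
  rw [covariantLiouvillian, poisson, liouvilleTerm]
  simp only [partialP, partialQ, hof]
  push_cast
  rw [sub_mul, Finset.sum_mul]
  simp only [mul_assoc]
  ring

end Hybrid

end Hybrid

end

/-! ### Assembly of the projected equation and the density transport. -/

theorem mainTheorem3 {n N : ℕ}
    {Q : Type*} [TopologicalSpace Q] [T2Space Q] [SecondCountableTopology Q]
    [ChartedSpace (Hybrid.Model n) Q] [IsManifold (𝓡 n) ∞ Q]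
    {𝓗 : Type*} [NormedAddCommGroup 𝓗] [InnerProductSpace ℂ 𝓗] [CompleteSpace 𝓗]
    (ħ : ℝ) (hħ : 0 < ħ)
    -- the mutually commuting quantum observables
    (α : Fin N → 𝓗 →ₗ.[ℂ] 𝓗) (hα : ∀ i, IsSelfAdjoint (α i))
    (hcomm : ∀ i j, Hybrid.StronglyCommute (α i) (α j))
    -- their joint eigenstates
    {X : Type*} [MeasurableSpace X] (ν : Measure X) [SigmaFinite ν]
    (B : Hybrid.JointEigenstates α ν)
    -- the Hamiltonian `H(z, a) = ∑ₘ h_m(z) a^m`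
    (H : Hybrid.PhaseSpace n Q → (Fin N → ℝ) → ℝ)
    (h : (Fin N → ℕ) → Hybrid.PhaseSpace n Q → ℝ)
    (hH : ∀ z, ∀ a ∈ Hybrid.jointSpectrum α, HasSum (fun m => h m z * ∏ i, a i ^ m i) (H z a))
    (hHreg : ∀ a ∈ Hybrid.jointSpectrum α,
      ContMDiff (Hybrid.phaseModel n) 𝓘(ℝ, ℝ) 2 (fun z => H z a))
    -- a solution of the quantum-classical wave equation with Hamiltonian `H(z, α)`
    (J : Set ℝ) (hJ : IsOpen J) (hJconn : J.OrdConnected)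
    (Υ : Hybrid.PhaseSpace n Q → ℝ → 𝓗)
    (hΥ : Hybrid.SolvesHybrid ħ (fun z => Hybrid.analyticFunction α (fun m => h m z)) J Υ)
    -- its projection `y x z t = ⟨x|Υ(z, t)⟩`
    (y : X → Hybrid.PhaseSpace n Q → ℝ → ℂ)
    (hy : ∀ t ∈ J, ∀ z, (fun x => y x z t) =ᵐ[ν] (B.proj (Υ z t) : X → ℂ))
    (hyreg : ∀ᵐ x ∂ν, ContMDiffOn ((Hybrid.phaseModel n).prod 𝓘(ℝ, ℝ)) 𝓘(ℝ, ℂ) 2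
      (fun zt : Hybrid.PhaseSpace n Q × ℝ => y x zt.1 zt.2) (univ ×ˢ J)) :
    ∀ᵐ x ∂ν,
      Hybrid.SolvesKvH ħ (fun z => H z (B.eigenvalue x)) J (y x) ∧
      Hybrid.SolvesLiouville (fun z => H z (B.eigenvalue x)) J
        (fun z t => Hybrid.density ħ (fun w => y x w t) z) ∧
      (∀ s ∈ J, ∀ t ∈ J, ∀ γ : ℝ → Hybrid.PhaseSpace n Q,
        IsMIntegralCurveOn γ (Hybrid.hamiltonianField fun z => H z (B.eigenvalue x)) (uIcc s t) →
        Hybrid.density ħ (fun w => y x w t) (γ t) = Hybrid.density ħ (fun w => y x w s) (γ s)) ∧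
      (Hybrid.IsCompleteHamiltonian (fun z => H z (B.eigenvalue x)) →
        ∀ s ∈ J, ∀ t ∈ J,
          ((∀ z, 0 ≤ Hybrid.density ħ (fun w => y x w s) z) →
            ∀ z, 0 ≤ Hybrid.density ħ (fun w => y x w t) z) ∧
          ((∀ z, Hybrid.density ħ (fun w => y x w s) z ≤ 0) →
            ∀ z, Hybrid.density ħ (fun w => y x w t) z ≤ 0)) := by
  have hspec := B.ae_eigenvalue_mem_jointSpectrum
  have hreg : ∀ᵐ x ∂ν, ContMDiff (Hybrid.phaseModel n) 𝓘(ℝ, ℝ) 2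
      (fun z => H z (B.eigenvalue x)) := hspec.mono fun x hx => hHreg _ hx
  have hT : ∀ z, B.ActsAs (Hybrid.analyticFunction α (fun m => h m z))
      (fun x => H z (B.eigenvalue x)) := fun z =>
    B.actsAs_analyticFunction (hspec.mono fun x hx => hH z _ hx)
  have hpoint : ∀ t ∈ J, ∀ z, ∀ᵐ x ∂ν, Complex.I * ħ * deriv (y x z) t =
      Hybrid.covariantLiouvillian ħ (fun w => H w (B.eigenvalue x)) (fun w => y x w t) z := by
    intro t ht z
    obtain ⟨h1, h2, h3⟩ := hΥ t ht z
    have h4 := B.bra_hybridLiouvillian hT (hreg.mono fun x hx => hx.mdifferentiableAt (by norm_num))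
      h2 (hy t ht) (hyreg.mono fun x hx => Hybrid.mdifferentiableAt_of_contMDiffOn hJ hx z ht) h3
    have h5 := B.deriv_ae_eq_bra h1 (y := fun x => y x z)
      (by filter_upwards [hJ.mem_nhds ht] with s hs using hy s hs z)
      (hyreg.mono fun x hx => Hybrid.differentiableAt_time_of_contMDiffOn hJ hx z ht)
    filter_upwards [h4, h5, B.bra_smul (Complex.I * ħ) (deriv (Υ z) t)] with x h6 h7 h8
    rw [h7, ← h8, h6]
  have := Hybrid.secondCountable_phaseSpace (n := n) (Q := Q)
  -- The null sets of `hpoint` depend on `(z, t)`. Over a countable set they have a null union, and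
  -- density is enough for the equation to extend by continuity.
  obtain ⟨D, hDc, hD⟩ := TopologicalSpace.exists_countable_dense (Hybrid.PhaseSpace n Q × ℝ)
  have hdense : ∀ᵐ x ∂ν, ∀ zt ∈ D, zt.2 ∈ J → Complex.I * ħ * deriv (y x zt.1) zt.2 =
      Hybrid.covariantLiouvillian ħ (fun w => H w (B.eigenvalue x)) (fun w => y x w zt.2) zt.1 :=
    (ae_ball_iff hDc).2 fun zt _ => ae_all_iff.2 fun ht => hpoint zt.2 ht zt.1
  filter_upwards [hreg, hyreg, hdense] with x hx hyx hDx
  have hK := Hybrid.solvesKvH_of_dense hħ.ne' hJ hx hyx hD hDx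
  refine ⟨hK, Hybrid.solvesLiouville_density hħ.ne' hJ hx hyx hK, fun s hs t ht γ hγ =>
    Hybrid.density_comp_integralCurve hħ.ne' hJ hJconn hx hyx hK hs ht hγ,
    fun hc s hs t ht => ⟨fun hpos z => ?_, fun hneg z => ?_⟩⟩ <;>
  obtain ⟨w, hw⟩ :=
    Hybrid.exists_density_eq_of_complete hħ.ne' hJ hJconn hx hyx hK hc hs ht z
  · exact hw ▸ hpos w
  · exact hw ▸ hneg w
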